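/- Let $0<\alpha\le\infty$ and $n\ge 2$. For a real $n\times n$ matrix $A=[a_{ij}]$ with entries in $(-\alpha,\alpha)$ write $f[A]=[f(a_{ij})]$, and for symmetric matrices let $X\ge Y$ mean that $X-Y$ is positive semidefinite. A function $f:(-\alpha,\alpha)\to\mathbb{R}$ is called S-convex of order $n$ if for all symmetric $A,B\in M_n(\mathbb{R})$ with entries in $(-\alpha,\alpha)$ and $A\ge B\ge 0$, $$f[tA+(1-t)B]\le t f[A]+(1-t)f[B]\qquad(0\le t\le 1).$$ Denote by $\lambda(A)$ the vector of eigenvalues of a symmetric matrix $A$ and by $s(A)$ the vector of singular values of $A$, both with multiplicity and in decreasing order. For $\mathbf a,\mathbf b\in\mathbb{R}^n$ let $\mathbf a\circ\mathbf b$ be the coordinatewise product, and let $\mathbf a\prec_w\mathbf b$ mean that for each $1\le k\le n$ the sum of the $k$ largest coordinates of $\mathbf a$ is at most the sum of the $k$ largest coordinates of $\mathbf b$. **Theorem.** Let $f$ be S-convex of order $n$ on $(-\alpha,\alpha)$ with $f'(0)\ge 0$. Then $f$ is differentiable on $(-\alpha,\alpha)$, and for all positive semidefinite $A,B\in M_n(\mathbb{R})$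 with operator norms $\|A\|,\|B\|<\alpha$, $$s(f[A]-f[B])\prec_w f^{[1]}(\lambda(A),\lambda(B))\circ s(A-B),$$ where $f^{[1]}(\lambda(A),\lambda(B))=\bigl(f^{[1]}(\lambda_1(A),\lambda_1(B)),\dots,f^{[1]}(\lambda_n(A),\lambda_n(B))\bigr)$, with $f^{[1]}(a,b)=\frac{f(a)-f(b)}{a-b}$ for $a\ne b$ and $f^{[1]}(a,a)=f'(a)$. -/

import Mathlib

noncomputable section

namespace SchurCalc

/-- The open interval `(-α, α)` of real numbers, where `0 < α ≤ ∞`. -/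
def symInterval (α : EReal) : Set ℝ :=
  {x : ℝ | -α < (x : EReal) ∧ (x : EReal) < α}

/-- The entrywise calculus `f[A] = [f (a i j)]`. -/
def entrywise {n : ℕ} (f : ℝ → ℝ) (A : Matrix (Fin n) (Fin n) ℝ) :
    Matrix (Fin n) (Fin n) ℝ :=
  Matrix.of fun i j => f (A i j)

/-- `f` is S-convex of order `n` on `(-α, α)`: for all symmetric real `n × n` matrices with
entries in `(-α, α)` and `A ≥ B ≥ 0` one has
`f[t A + (1 - t) B] ≤ t f[A] + (1 - t) f[B]` for `0 ≤ t ≤ 1`, in the order of positive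
semidefiniteness. Only the values of `f` on `(-α, α)` matter. -/
def SConvexOfOrder (n : ℕ) (α : EReal) (f : ℝ → ℝ) : Prop :=
  ∀ A B : Matrix (Fin n) (Fin n) ℝ, A.IsSymm → B.IsSymm →
    (∀ i j, A i j ∈ symInterval α) → (∀ i j, B i j ∈ symInterval α) →
    (A - B).PosSemidef → B.PosSemidef →
    ∀ t : ℝ, 0 ≤ t → t ≤ 1 →
      (t • entrywise f A + (1 - t) • entrywise f B
        - entrywise f (t • A + (1 - t) • B)).PosSemidef

/-- The eigenvalues `λ₁(A) ≥ ⋯ ≥ λₙ(A)` of a symmetric real matrix, with multiplicity, in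
decreasing order. -/
def eigs {n : ℕ} {A : Matrix (Fin n) (Fin n) ℝ} (hA : A.IsHermitian) : Fin n → ℝ :=
  fun i => hA.eigenvalues₀ (Fin.cast (Fintype.card_fin n).symm i)

/-- The singular values `s₁(A) ≥ ⋯ ≥ sₙ(A)`, with multiplicity, in decreasing order. -/
def sing {n : ℕ} (A : Matrix (Fin n) (Fin n) ℝ) : Fin n → ℝ :=
  fun i => (Matrix.toEuclideanLin A).singularValues (i : ℕ)

/-- The decreasing rearrangement of the coordinates of a vector. -/
def decr {n : ℕ} (a : Fin n → ℝ) : Fin n → ℝ :=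
  fun i => a (Tuple.sort a (Fin.rev i))

theorem decr_antitone {n : ℕ} (a : Fin n → ℝ) : Antitone (decr a) := by
  intro i j hij
  exact Tuple.monotone_sort a (Fin.rev_le_rev.mpr hij)

/-- Weak majorization: for every `k` the sum of the `k` largest coordinates of `a` is at most
the sum of the `k` largest coordinates of `b`. (The sum over `Finset.Iic k` has `k + 1` terms,
as `Fin n` starts at `0`.) -/
def WeakMaj {n : ℕ} (a b : Fin n → ℝ) : Prop :=
  ∀ k : Fin n, ∑ i ∈ Finset.Iic k, decr a i ≤ ∑ i ∈ Finset.Iic k, decr b i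

/-- The first divided difference of `f`. -/
def divDiff (f : ℝ → ℝ) (a b : ℝ) : ℝ :=
  if a = b then deriv f a else (f a - f b) / (a - b)

/-- The operator norm of a matrix with respect to the Euclidean norm. -/
def opNorm {n : ℕ} (A : Matrix (Fin n) (Fin n) ℝ) : ℝ :=
  ‖Matrix.toEuclideanCLM (n := Fin n) (𝕜 := ℝ) A‖

end SchurCalc

end

noncomputable section

namespace SchurCalc

open Finset Matrix Filter Topology

/-! Entrywise, f[A] - f[B] = C ⊙ (A - B), where C is the integral over t in [0, 1] of f'[B + t(A -
B)]. The estimate rests on three facts: C is positive semidefinite, the diagonal of C is weakly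
majorized by the divided differences at the eigenvalues, and for positive semidefinite C the
singular values of C ⊙ X are controlled by such a majorant times those of X
(`headSum_sing_hadamard_le`).

Positivity of C: with J the all-ones matrix, S-convexity on the segment from M to M + hJ makes the
convexity defect of f preserve positivity. Its end slopes in t show that h(f'(x + h) - f'(x)) does
too. Integrating along sM with the Schur product theorem, then dividing by h, gives f'[M] ≥ f'(0)J ≥
0.

Diagonal of C: by Schur, the diagonals of A and B are majorized by their spectra. Since f' is
nondecreasing and convex on the nonnegative part of the interval, Tomić–Weyl applies at each t, and
integrating gives the claim.

Smoothness: an entrywise positivity preserver satisfies |G(x)| ≤ G(b) for |x| ≤ b, so the defect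
grows with the base point. It is therefore bounded by its average over a short interval, which is
the defect of a function with Lipschitz derivative. Hence the defect is quadratically small, Ky² ± f
are locally convex, and f is continuously differentiable. -/

/-! ### Partial sums, rearrangement and weak majorization -/

/-- The sum of the first `m` coordinates of a vector. -/
def headSum {n : ℕ} (a : Fin n → ℝ) (m : ℕ) : ℝ :=
  ∑ i : Fin n, if (i : ℕ) < m then a i else 0

theorem sum_Iic_eq_headSum {n : ℕ} (a : Fin n → ℝ) (k : Fin n) :
    ∑ i ∈ Iic k, a i = headSum a (k + 1) := by
  have h : (Iic k : Finset (Fin n)) = univ.filter fun i : Fin n => (i : ℕ) < (k : ℕ) + 1 := by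
    refine Finset.ext fun i => ?_
    rw [Finset.mem_Iic, Finset.mem_filter, Fin.le_def, Nat.lt_succ_iff]
    simp only [Finset.mem_univ, true_and]
  rw [headSum, h, Finset.sum_filter]

theorem headSum_castSucc {n : ℕ} (a : Fin (n + 1) → ℝ) {m : ℕ} (hm : m ≤ n) :
    headSum (fun i : Fin n => a i.castSucc) m = headSum a m := by
  simp [headSum, Fin.sum_univ_castSucc, not_lt.mpr hm]

theorem headSum_self {n : ℕ} (a : Fin n → ℝ) : headSum a n = ∑ i, a i := by
  simp [headSum]

theorem headSum_castLE {m n : ℕ} (h : m ≤ n) (a : Fin n → ℝ) {r : ℕ} (hr : r ≤ m) :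
    headSum (fun i : Fin m => a (Fin.castLE h i)) r = headSum a r := by
  simp only [headSum, ← Finset.sum_filter]
  refine Finset.sum_bij (fun i _ => Fin.castLE h i) ?_ ?_ ?_ ?_
  · intro i hi
    simpa using hi
  · intro i _ j _ hij
    simpa using hij
  · intro j hj
    have hj' : (j : ℕ) < r := by simpa using hj
    exact ⟨⟨j, hj'.trans_le hr⟩, by simpa using hj', rfl⟩
  · intro i _
    rfl

theorem headSum_sub {n : ℕ} (a b : Fin n → ℝ) (m : ℕ) :
    headSum (fun i => a i - b i) m = headSum a m - headSum b m := by
  simp only [headSum, ← Finset.sum_sub_distrib]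
  exact Finset.sum_congr rfl fun i _ => by split_ifs <;> simp

/-- Truncating a vector after `k` coordinates. -/
theorem headSum_truncate {n : ℕ} (a : Fin n → ℝ) (k m : ℕ) :
    headSum (fun i : Fin n => if (i : ℕ) < k then a i else 0) m = headSum a (min m k) := by
  simp only [headSum]
  refine Finset.sum_congr rfl fun i _ => ?_
  simp only [lt_min_iff, ite_and]

/-- Abel summation: a decreasing weight turns nonnegative partial sums into a lower bound. -/
theorem mul_sum_le_sum_mul_of_headSum_nonneg {n : ℕ} :
    ∀ {s x : Fin n → ℝ} {c : ℝ}, Antitone s → (∀ i, c ≤ s i) →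
      (∀ m ≤ n, 0 ≤ headSum x m) → c * ∑ i, x i ≤ ∑ i, s i * x i := by
  induction n with
  | zero => intro s x c _ _ _; simp
  | succ n ih =>
    intro s x c hs hc hx
    -- The induction uses the last weight as lower bound; only afterwards is it compared with c,
    -- against the nonnegative total sum.
    have h1 := ih (s := fun i => s i.castSucc) (x := fun i => x i.castSucc)
      (c := s (Fin.last n)) (fun i j hij => hs (Fin.castSucc_le_castSucc_iff.mpr hij))
      (fun i => hs (Fin.le_last _))
      (fun m hm => by rw [headSum_castSucc x hm]; exact hx m (by omega))
    have h2 := hx (n + 1) le_rfl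
    rw [headSum_self, Fin.sum_univ_castSucc] at h2
    rw [Fin.sum_univ_castSucc, Fin.sum_univ_castSucc]
    nlinarith [mul_le_mul_of_nonneg_right (hc (Fin.last n)) h2]

theorem sum_mul_le_sum_mul_of_headSum_le {n : ℕ} {s g d : Fin n → ℝ} (hs : Antitone s)
    (hs0 : ∀ i, 0 ≤ s i) (h : ∀ m ≤ n, headSum g m ≤ headSum d m) :
    ∑ i, s i * g i ≤ ∑ i, s i * d i := by
  have := mul_sum_le_sum_mul_of_headSum_nonneg (x := fun i => d i - g i) hs hs0
    (fun m hm => by rw [headSum_sub]; exact sub_nonneg.mpr (h m hm))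
  simp only [mul_sub, Finset.sum_sub_distrib] at this
  linarith

theorem headSum_const_one {n m : ℕ} (hm : m ≤ n) :
    headSum (fun _ : Fin n => (1 : ℝ)) m = m := by
  rw [← headSum_castLE hm _ le_rfl, headSum_self]
  simp

/-- Weights in `[0, 1]` of total mass at most `m` pick at most the `m` largest coordinates. -/
theorem sum_mul_weight_le_headSum {n m : ℕ} {s w : Fin n → ℝ} (hs : Antitone s)
    (hs0 : ∀ i, 0 ≤ s i) (hw0 : ∀ i, 0 ≤ w i) (hw1 : ∀ i, w i ≤ 1) (hw : ∑ i, w i ≤ m) :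
    ∑ i, s i * w i ≤ headSum s m := by
  have h : ∑ i, s i * w i ≤ ∑ i : Fin n, s i * (if (i : ℕ) < m then 1 else 0) := by
    refine sum_mul_le_sum_mul_of_headSum_le hs hs0 fun r hr => ?_
    rw [headSum_truncate (fun _ => (1 : ℝ)), headSum_const_one ((min_le_left _ _).trans hr)]
    push_cast
    refine le_min ?_ ?_
    · rw [← headSum_const_one hr]
      exact Finset.sum_le_sum fun i _ => by split_ifs <;> simp [hw1]
    · refine le_trans (Finset.sum_le_sum fun i _ => ?_) hw
      split_ifs <;> simp [hw0]
  simpa [headSum] using h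

theorem decr_eq_self_of_antitone {n : ℕ} {a : Fin n → ℝ} (ha : Antitone a) : decr a = a := by
  have h := Tuple.unique_monotone (f := a) (σ := Tuple.sort a) (τ := Fin.revPerm)
    (Tuple.monotone_sort a) (fun i j hij => ha (Fin.rev_le_rev.mpr hij))
  funext i
  have := congrFun h (Fin.rev i)
  simpa [decr] using this

/-- The permutation that puts the coordinates of a vector into decreasing order. -/
def decrPerm {n : ℕ} (a : Fin n → ℝ) : Equiv.Perm (Fin n) := Fin.revPerm.trans (Tuple.sort a)

theorem headSum_decr {n m : ℕ} (a : Fin n → ℝ) (hm : m ≤ n) :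
    ∃ T : Finset (Fin n), T.card = m ∧ ∑ i ∈ T, a i = headSum (decr a) m := by
  refine ⟨univ.map ((Fin.castLEEmb hm).trans (decrPerm a).toEmbedding), by simp, ?_⟩
  rw [← headSum_castLE hm _ le_rfl, headSum_self, Finset.sum_map]
  rfl

/-- Sorting c reduces this to the decreasing case, where the extremal weight is the indicator of the
m largest entries. It is applied to the diagonal of C. -/
theorem sum_mul_weight_le_of_subset_sum_le {n m : ℕ} (hm : m ≤ n) {c w : Fin n → ℝ} {D : ℝ}
    (hc0 : ∀ i, 0 ≤ c i) (hw0 : ∀ i, 0 ≤ w i) (hw1 : ∀ i, w i ≤ 1) (hw : ∑ i, w i ≤ m)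
    (hD : ∀ T : Finset (Fin n), T.card = m → ∑ i ∈ T, c i ≤ D) :
    ∑ i, c i * w i ≤ D := by
  obtain ⟨T, hT, hsum⟩ := headSum_decr c hm
  rw [← Equiv.sum_comp (decrPerm c)]
  refine le_trans (sum_mul_weight_le_headSum (s := decr c)
    (w := fun i => w (decrPerm c i)) (decr_antitone c) (fun i => hc0 _) (fun i => hw0 _)
    (fun i => hw1 _) ?_) (hsum ▸ hD T hT)
  rwa [Equiv.sum_comp (decrPerm c) w]

/-- A subgradient of a monotone convex function, monotone in the base point. -/
theorem exists_monotone_subgradient {D : Set ℝ} {φ : ℝ → ℝ} (hφ : ConvexOn ℝ D φ)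
    (hmono : MonotoneOn φ D) (hD : ∀ x ∈ D, ∃ y ∈ D, x < y) :
    ∃ c : ℝ → ℝ, MonotoneOn c D ∧ (∀ x ∈ D, 0 ≤ c x) ∧
      ∀ x ∈ D, ∀ y ∈ D, c x * (y - x) ≤ φ y - φ x := by
  -- The infimum of the right difference quotients is the right derivative; `hD` keeps this set
  -- nonempty.
  let S : ℝ → Set ℝ := fun x => (fun y => (φ y - φ x) / (y - x)) '' {y | y ∈ D ∧ x < y}
  have hS0 : ∀ x ∈ D, ∀ v ∈ S x, 0 ≤ v := by
    rintro x hx _ ⟨y, ⟨hy, hxy⟩, rfl⟩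
    exact div_nonneg (sub_nonneg.mpr (hmono hx hy hxy.le)) (sub_nonneg.mpr hxy.le)
  have hne : ∀ x ∈ D, (S x).Nonempty := fun x hx => by
    obtain ⟨y, hy, hxy⟩ := hD x hx
    exact ⟨_, y, ⟨hy, hxy⟩, rfl⟩
  have hbd : ∀ x ∈ D, BddBelow (S x) := fun x hx => ⟨0, hS0 x hx⟩
  have hup : ∀ x ∈ D, ∀ y ∈ D, x < y → sInf (S x) ≤ (φ y - φ x) / (y - x) :=
    fun x hx y hy hxy => csInf_le (hbd x hx) ⟨y, ⟨hy, hxy⟩, rfl⟩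
  have hlo : ∀ x ∈ D, ∀ y ∈ D, y < x → (φ x - φ y) / (x - y) ≤ sInf (S x) := by
    intro x hx y hy hyx
    refine le_csInf (hne x hx) ?_
    rintro _ ⟨z, ⟨hz, hxz⟩, rfl⟩
    exact hφ.slope_mono_adjacent hy hz hyx hxz
  refine ⟨fun x => sInf (S x), ?_, fun x hx => le_csInf (hne x hx) (hS0 x hx), ?_⟩
  · intro x hx y hy hxy
    rcases hxy.eq_or_lt with rfl | hxy
    · exact le_rfl
    · exact (hup x hx y hy hxy).trans (hlo y hy x hx hxy)
  · intro x hx y hy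
    rcases lt_trichotomy x y with h | rfl | h
    · exact (le_div_iff₀ (sub_pos.mpr h)).mp (hup x hx y hy h)
    · simp
    · have := (div_le_iff₀ (sub_pos.mpr h)).mp (hlo x hx y hy h)
      dsimp only
      linarith

/-- **Tomić–Weyl**: monotone convex functions preserve weak majorization. -/
theorem sum_convex_le_of_headSum_le {D : Set ℝ} {φ : ℝ → ℝ} (hφ : ConvexOn ℝ D φ)
    (hmono : MonotoneOn φ D) (hD : ∀ x ∈ D, ∃ y ∈ D, x < y) {m : ℕ} {d μ : Fin m → ℝ}
    (hd : ∀ i, d i ∈ D) (hμ : ∀ i, μ i ∈ D) (hanti : Antitone d)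
    (h : ∀ r ≤ m, headSum d r ≤ headSum μ r) : ∑ i, φ (d i) ≤ ∑ i, φ (μ i) := by
  obtain ⟨c, hcm, hc0, hc⟩ := exists_monotone_subgradient hφ hmono hD
  have h1 := sum_mul_le_sum_mul_of_headSum_le (s := fun i => c (d i))
    (fun i j hij => hcm (hd j) (hd i) (hanti hij)) (fun i => hc0 _ (hd i)) h
  have h2 := Finset.sum_le_sum fun i (_ : i ∈ univ) => hc _ (hd i) _ (hμ i)
  simp only [mul_sub, Finset.sum_sub_distrib] at h2
  linarith

/-- Tomić–Weyl on the entries of d over T, sorted, against the first |T| coordinates of μ; the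
hypothesis on subsets of T supplies the partial sums. No order on μ is required. -/
theorem sum_convex_le_headSum {D : Set ℝ} {φ : ℝ → ℝ} (hφ : ConvexOn ℝ D φ)
    (hmono : MonotoneOn φ D) (hD : ∀ x ∈ D, ∃ y ∈ D, x < y) {n : ℕ} {d μ : Fin n → ℝ}
    (hd : ∀ i, d i ∈ D) (hμ : ∀ i, μ i ∈ D)
    (h : ∀ T : Finset (Fin n), ∑ i ∈ T, d i ≤ headSum μ T.card) (T : Finset (Fin n)) :
    ∑ i ∈ T, φ (d i) ≤ headSum (fun i => φ (μ i)) T.card := by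
  have hT : T.card ≤ n := by simpa using T.card_le_univ
  let e : Fin T.card ↪ Fin n := T.equivFin.symm.toEmbedding.trans (Function.Embedding.subtype _)
  let g : Fin T.card → ℝ := fun i => d (e i)
  have hsum : ∑ i ∈ T, φ (d i) = ∑ i, φ (decr g i) := by
    rw [← Finset.sum_coe_sort T, ← Equiv.sum_comp T.equivFin.symm,
      ← Equiv.sum_comp (decrPerm g)]
    rfl
  rw [hsum, ← headSum_castLE hT _ le_rfl, headSum_self]
  refine sum_convex_le_of_headSum_le hφ hmono hD (fun i => hd _) (fun i => hμ _)
    (decr_antitone g) fun r hr => ?_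
  rw [headSum_castLE hT _ hr]
  obtain ⟨R, hR, hRs⟩ := headSum_decr g hr
  have := h (R.map e)
  rw [Finset.sum_map, Finset.card_map, hR] at this
  exact hRs ▸ this

/-! ### Bessel families and positive semidefinite forms -/

/-- A finite family of vectors satisfying Bessel's inequality. -/
def IsBessel {ι : Type*} [Fintype ι] {n : ℕ} (u : ι → Fin n → ℝ) : Prop :=
  ∀ z : Fin n → ℝ, ∑ l, (∑ i, u l i * z i) ^ 2 ≤ ∑ i, z i ^ 2

theorem IsBessel.sum_sq_apply_le_one {ι : Type*} [Fintype ι] {n : ℕ} {u : ι → Fin n → ℝ}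
    (hu : IsBessel u) (i : Fin n) : ∑ l, u l i ^ 2 ≤ 1 := by
  have := hu (Pi.single i 1)
  simpa [Pi.single_apply] using this

theorem IsBessel.sum_sq_le_one {ι : Type*} [Fintype ι] {n : ℕ} {u : ι → Fin n → ℝ}
    (hu : IsBessel u) (l : ι) : ∑ i, u l i ^ 2 ≤ 1 := by
  -- Bessel tested on `u l` gives S² ≤ S for its squared norm S.
  have h1 := hu (u l)
  have h2 := Finset.single_le_sum (f := fun k => (∑ i, u k i * u l i) ^ 2)
    (fun k _ => sq_nonneg _) (Finset.mem_univ l)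
  have h3 : ∑ i, u l i * u l i = ∑ i, u l i ^ 2 := Finset.sum_congr rfl fun i _ => by ring
  have h4 := h2.trans h1
  simp only [h3] at h4
  nlinarith [Finset.sum_nonneg fun i (_ : i ∈ univ) => sq_nonneg (u l i)]

/-- The bilinear form of a matrix. -/
def bform {n : ℕ} (C : Matrix (Fin n) (Fin n) ℝ) (a b : Fin n → ℝ) : ℝ :=
  ∑ i, ∑ j, a i * C i j * b j

theorem bform_eq_dotProduct {n : ℕ} (C : Matrix (Fin n) (Fin n) ℝ) (a b : Fin n → ℝ) :
    bform C a b = a ⬝ᵥ (C *ᵥ b) := by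
  simp only [bform, dotProduct, mulVec, Finset.mul_sum]
  exact Finset.sum_congr rfl fun i _ => Finset.sum_congr rfl fun j _ => by ring

theorem posSemidef_iff_bform {n : ℕ} (C : Matrix (Fin n) (Fin n) ℝ) :
    C.PosSemidef ↔ C.IsSymm ∧ ∀ z, 0 ≤ bform C z z := by
  rw [posSemidef_iff_dotProduct_mulVec]
  simp only [bform_eq_dotProduct, Matrix.IsHermitian, conjTranspose_eq_transpose_of_trivial,
    star_trivial, Matrix.IsSymm]

theorem bform_le_of_posSemidef {n : ℕ} {C : Matrix (Fin n) (Fin n) ℝ} (hC : C.PosSemidef)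
    (a b : Fin n → ℝ) : bform C a b ≤ (bform C a a + bform C b b) / 2 := by
  have h := ((posSemidef_iff_bform C).mp hC).2 (a - b)
  have hs : bform C b a = bform C a b := by
    rw [bform, Finset.sum_comm]
    refine Finset.sum_congr rfl fun i _ => Finset.sum_congr rfl fun j _ => ?_
    rw [((posSemidef_iff_bform C).mp hC).1.apply i j]
    ring
  have h2 : bform C (a - b) (a - b)
      = bform C a a - bform C a b - bform C b a + bform C b b := by
    simp only [bform, ← Finset.sum_add_distrib, ← Finset.sum_sub_distrib]
    refine Finset.sum_congr rfl fun i _ => Finset.sum_congr rfl fun j _ => ?_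
    simp only [Pi.sub_apply]
    ring
  linarith

-- Writing C = YᵀY turns the form into a sum of squares over the rows of Y, and Bessel applies to
-- each row multiplied coordinatewise by u.
open scoped MatrixOrder in
theorem sum_bform_mul_le {ι : Type*} [Fintype ι] {n : ℕ} {C : Matrix (Fin n) (Fin n) ℝ}
    (hC : C.PosSemidef) {p : ι → Fin n → ℝ} (hp : IsBessel p) (u : Fin n → ℝ) :
    ∑ j, bform C (u * p j) (u * p j) ≤ ∑ i, C i i * u i ^ 2 := by
  obtain ⟨Y, rfl⟩ := (CStarAlgebra.nonneg_iff_eq_star_mul_self (a := C)).mp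
    (Matrix.nonneg_iff_posSemidef.mpr hC)
  have hq : ∀ z : Fin n → ℝ, bform (star Y * Y) z z = ∑ m, (∑ i, Y m i * z i) ^ 2 := by
    intro z
    rw [bform_eq_dotProduct, ← mulVec_mulVec, dotProduct_mulVec, star_eq_conjTranspose,
      conjTranspose_eq_transpose_of_trivial, vecMul_transpose]
    simp only [dotProduct, mulVec, sq]
  simp only [hq]
  rw [Finset.sum_comm]
  have hd : ∀ i, (star Y * Y) i i = ∑ m, Y m i ^ 2 := fun i => by
    simp [Matrix.mul_apply, star_eq_conjTranspose, sq]
  simp only [hd, Finset.sum_mul]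
  rw [Finset.sum_comm (s := univ) (t := univ) (f := fun i m => Y m i ^ 2 * u i ^ 2)]
  refine Finset.sum_le_sum fun m _ => ?_
  refine le_trans (le_of_eq ?_) ((hp fun i => Y m i * u i).trans (le_of_eq ?_))
  · refine Finset.sum_congr rfl fun j _ => ?_
    congr 1
    exact Finset.sum_congr rfl fun i _ => by simp only [Pi.mul_apply]; ring
  · exact Finset.sum_congr rfl fun i _ => by ring

theorem IsBessel.comp {ι κ : Type*} [Fintype ι] [Fintype κ] {n : ℕ} {u : ι → Fin n → ℝ}
    (hu : IsBessel u) (e : κ ↪ ι) : IsBessel fun k => u (e k) := by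
  intro z
  refine le_trans ?_ (hu z)
  rw [← Finset.sum_map univ e (fun l => (∑ i, u l i * z i) ^ 2)]
  exact Finset.sum_le_sum_of_subset_of_nonneg (Finset.subset_univ _) fun _ _ _ => sq_nonneg _

/-- Summing out p leaves the diagonal of C with weights ∑ₗ (u l i)², which lie in [0, 1] and have
total mass at most m. -/
theorem sum_sum_bform_mul_le {m r n : ℕ} (hm : m ≤ n) {C : Matrix (Fin n) (Fin n) ℝ}
    (hC : C.PosSemidef) {u : Fin m → Fin n → ℝ} (hu : IsBessel u) {p : Fin r → Fin n → ℝ}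
    (hp : IsBessel p) {D : ℝ}
    (hD : ∀ T : Finset (Fin n), T.card = m → ∑ i ∈ T, C i i ≤ D) :
    ∑ l, ∑ j, bform C (u l * p j) (u l * p j) ≤ D := by
  refine (Finset.sum_le_sum fun l _ => sum_bform_mul_le hC hp (u l)).trans ?_
  rw [Finset.sum_comm]
  simp only [← Finset.mul_sum]
  refine sum_mul_weight_le_of_subset_sum_le hm (fun i => hC.diag_nonneg)
    (fun i => Finset.sum_nonneg fun _ _ => sq_nonneg _) hu.sum_sq_apply_le_one ?_ hD
  rw [Finset.sum_comm]
  exact (Finset.sum_le_sum fun l _ => hu.sum_sq_le_one l).trans (by simp)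

/-! ### Singular value decomposition -/

theorem inner_eq_sum {n : ℕ} (x y : EuclideanSpace ℝ (Fin n)) :
    inner ℝ x y = ∑ i, x i * y i := by
  rw [PiLp.inner_apply]
  exact Finset.sum_congr rfl fun i _ => by simp [mul_comm]

theorem isBessel_of_orthogonal {ι : Type*} [Fintype ι] {n : ℕ}
    {w : ι → EuclideanSpace ℝ (Fin n)} (hw : ∀ k l, k ≠ l → inner ℝ (w k) (w l) = (0 : ℝ))
    (hw1 : ∀ l, inner ℝ (w l) (w l) ≤ (1 : ℝ)) : IsBessel fun l i => w l i := by
  intro z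
  let z' : EuclideanSpace ℝ (Fin n) := WithLp.toLp 2 z
  let c : ι → ℝ := fun l => inner ℝ (w l) z'
  have h0 : (0 : ℝ) ≤ inner ℝ (z' - ∑ l, c l • w l) (z' - ∑ l, c l • w l) :=
    real_inner_self_nonneg
  have h1 : inner ℝ (∑ l, c l • w l) z' = ∑ l, c l ^ 2 := by
    rw [sum_inner]
    exact Finset.sum_congr rfl fun l _ => by rw [inner_smul_left]; simp [c, sq]
  have h2 : inner ℝ (∑ l, c l • w l) (∑ l, c l • w l) ≤ ∑ l, c l ^ 2 := by
    rw [sum_inner]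
    refine Finset.sum_le_sum fun l _ => ?_
    rw [inner_smul_left, inner_sum, Finset.sum_eq_single l]
    · rw [inner_smul_right]
      have := mul_le_mul_of_nonneg_left (hw1 l) (sq_nonneg (c l))
      simp only [conj_trivial]
      nlinarith
    · intro b _ hb
      rw [inner_smul_right, hw l b hb.symm, mul_zero]
    · simp
  rw [inner_sub_left, inner_sub_right, inner_sub_right, real_inner_comm (∑ l, c l • w l) z',
    h1] at h0
  have h3 : inner ℝ z' z' = ∑ i, z i ^ 2 := by
    rw [inner_eq_sum]
    exact Finset.sum_congr rfl fun i _ => by simp [z', sq]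
  have h4 : ∀ l, c l = ∑ i, w l i * z i := fun l => inner_eq_sum _ _
  simp only [← h4]
  linarith

theorem isBessel_of_orthonormal {ι : Type*} [Fintype ι] {n : ℕ}
    {w : ι → EuclideanSpace ℝ (Fin n)} (hw : Orthonormal ℝ w) : IsBessel fun l i => w l i :=
  isBessel_of_orthogonal (fun _ _ h => hw.2 h) fun l => by simp [hw.1 l]

theorem apply_eq_sum_of_apply_basis {n : ℕ} (X : Matrix (Fin n) (Fin n) ℝ)
    (v : OrthonormalBasis (Fin n) ℝ (EuclideanSpace ℝ (Fin n))) (i j : Fin n) :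
    X i j = ∑ l, Matrix.toEuclideanLin X (v l) i * v l j := by
  have he : EuclideanSpace.single j (1 : ℝ) = ∑ l, v l j • v l := by
    conv_lhs => rw [← v.sum_repr (EuclideanSpace.single j (1 : ℝ))]
    refine Finset.sum_congr rfl fun l _ => ?_
    rw [v.repr_apply_apply, EuclideanSpace.inner_single_right]
    simp
  have hX : X i j = Matrix.toEuclideanLin X (EuclideanSpace.single j (1 : ℝ)) i := by
    simp [Matrix.toLpLin_apply]
  rw [hX, he, map_sum]
  simp only [map_smul, WithLp.ofLp_sum, Finset.sum_apply, PiLp.smul_apply, smul_eq_mul]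
  exact Finset.sum_congr rfl fun l _ => by ring

/-- A singular value decomposition: `X` is a sum of rank one matrices built from two Bessel
families, the coefficients being the singular values, which the families also recover. -/
theorem exists_svd {n : ℕ} (X : Matrix (Fin n) (Fin n) ℝ) :
    ∃ p q : Fin n → Fin n → ℝ, IsBessel p ∧ IsBessel q ∧
      (∀ i j, X i j = ∑ l, sing X l * p l i * q l j) ∧ ∀ l, bform X (p l) (q l) = sing X l := by
  let T := Matrix.toEuclideanLin X
  have hdim : Module.finrank ℝ (EuclideanSpace ℝ (Fin n)) = n := finrank_euclideanSpace_fin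
  let hT := T.isSymmetric_adjoint_comp_self
  let v := hT.eigenvectorBasis hdim
  have hs : ∀ l : Fin n, T.singularValues (l : ℕ) ^ 2 = hT.eigenvalues hdim l :=
    fun l => T.sq_singularValues_fin hdim l
  have hTT : ∀ k l, inner ℝ (T (v k)) (T (v l)) = if k = l then sing X l ^ 2 else 0 := by
    intro k l
    have h := hT.apply_eigenvectorBasis hdim l
    rw [← LinearMap.adjoint_inner_right]
    have : (LinearMap.adjoint T) (T (v l)) = (hT.eigenvalues hdim l) • v l := h
    rw [this, inner_smul_right, orthonormal_iff_ite.mp v.orthonormal, ← hs]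
    simp [sing, T]
  -- For a zero singular value the inverse is 0, so `u l` vanishes. The family is orthogonal with
  -- norms 0 or 1, which still suffices for Bessel.
  let u : Fin n → EuclideanSpace ℝ (Fin n) := fun l => (sing X l)⁻¹ • T (v l)
  have hu0 : ∀ l, sing X l • u l = T (v l) := by
    intro l
    by_cases h : sing X l = 0
    · have := hTT l l
      rw [if_pos rfl, h, zero_pow two_ne_zero, inner_self_eq_zero] at this
      rw [h, this, zero_smul]
    · simp only [u]
      rw [smul_smul, mul_inv_cancel₀ h, one_smul]
  have huu : ∀ k l, inner ℝ (u k) (u l) = if k = l ∧ sing X l ≠ 0 then (1 : ℝ) else 0 := by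
    intro k l
    simp only [u, inner_smul_left, inner_smul_right, hTT]
    by_cases hkl : k = l
    · subst hkl
      by_cases h : sing X k = 0
      · simp [h]
      · simp [h, sq]
    · simp [hkl]
  have happ : ∀ l i, T (v l) i = ∑ j, X i j * v l j := by
    intro l i
    simp [T, Matrix.toLpLin_apply, mulVec, dotProduct]
  have hcoord : ∀ l i, T (v l) i = sing X l * u l i := by
    intro l i
    rw [← hu0 l]
    simp
  refine ⟨fun l i => u l i, fun l i => v l i, isBessel_of_orthogonal ?_ ?_,
    isBessel_of_orthonormal v.orthonormal, ?_, ?_⟩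
  · intro k l hkl
    simp [huu, hkl]
  · intro l
    rw [huu]
    split_ifs <;> simp
  · intro i j
    rw [apply_eq_sum_of_apply_basis X v]
    simp only [← hcoord]
    rfl
  · intro l
    have : bform X (fun i => u l i) (fun i => v l i) = inner ℝ (u l) (T (v l)) := by
      rw [inner_eq_sum, bform]
      refine Finset.sum_congr rfl fun i _ => ?_
      rw [happ, Finset.mul_sum]
      exact Finset.sum_congr rfl fun j _ => by ring
    rw [this, ← hu0, inner_smul_right, huu]
    by_cases h : sing X l = 0 <;> simp [h]

theorem sing_nonneg {n : ℕ} (X : Matrix (Fin n) (Fin n) ℝ) (l : Fin n) : 0 ≤ sing X l :=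
  LinearMap.singularValues_nonneg _ _

theorem sing_antitone {n : ℕ} (X : Matrix (Fin n) (Fin n) ℝ) : Antitone (sing X) :=
  fun _ _ hij => LinearMap.singularValues_antitone _ hij

/-! ### Singular values of Hadamard products -/

/-- Weak majorization of the singular values of a Hadamard product with a positive semidefinite
matrix `C`: the role of the diagonal of `C` may be played by any vector majorizing it. -/
theorem headSum_sing_hadamard_le {n : ℕ} {C : Matrix (Fin n) (Fin n) ℝ} (hC : C.PosSemidef)
    (X : Matrix (Fin n) (Fin n) ℝ) {d : Fin n → ℝ}
    (hd : ∀ T : Finset (Fin n), ∑ i ∈ T, C i i ≤ headSum d T.card) {m : ℕ} (hm : m ≤ n) :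
    headSum (sing (C ⊙ X)) m ≤ headSum (fun i => d i * sing X i) m := by
  obtain ⟨u, v, hu, hv, -, huv⟩ := exists_svd (C ⊙ X)
  obtain ⟨p, q, hp, hq, hX, -⟩ := exists_svd X
  let e := Fin.castLEEmb hm
  -- Expanding both decompositions, the coefficient of `sing X j` is ∑ₗ C(uₗpⱼ, vₗqⱼ), with
  -- coordinatewise products; g j is its bound by the arithmetic mean of the two diagonal values of
  -- the form.
  let g : Fin n → ℝ := fun j => ((∑ l : Fin m, bform C (u (e l) * p j) (u (e l) * p j))
    + ∑ l : Fin m, bform C (v (e l) * q j) (v (e l) * q j)) / 2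
  -- The double sum is symmetric in the two families, so either can provide the weights; taking the
  -- shorter one gives min r m.
  have key : ∀ (a b : Fin n → Fin n → ℝ), IsBessel a → IsBessel b → ∀ r ≤ n,
      headSum (fun j => ∑ l : Fin m, bform C (a (e l) * b j) (a (e l) * b j)) r
        ≤ headSum d (min r m) := by
    intro a b ha hb r hr
    rw [← headSum_castLE hr _ le_rfl, headSum_self]
    rcases min_choice r m with h | h
    · rw [h]
      have := sum_sum_bform_mul_le hr hC (hb.comp (Fin.castLEEmb hr)) (ha.comp e)
        (fun T hT => hT ▸ hd T)
      refine le_trans (le_of_eq ?_) this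
      exact Finset.sum_congr rfl fun j _ => Finset.sum_congr rfl fun l _ => by
        rw [mul_comm]; rfl
    · rw [h, Finset.sum_comm]
      exact sum_sum_bform_mul_le hm hC (ha.comp e) (hb.comp (Fin.castLEEmb hr))
        (fun T hT => hT ▸ hd T)
  have hg : ∀ r ≤ n, headSum g r ≤ headSum (fun j : Fin n => if (j : ℕ) < m then d j else 0) r := by
    intro r hr
    rw [headSum_truncate]
    have h1 := key u p hu hp r hr
    have h2 := key v q hv hq r hr
    have h3 : headSum g r
        = (headSum (fun j => ∑ l : Fin m, bform C (u (e l) * p j) (u (e l) * p j)) r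
          + headSum (fun j => ∑ l : Fin m, bform C (v (e l) * q j) (v (e l) * q j)) r) / 2 := by
      simp only [headSum, ← Finset.sum_add_distrib, Finset.sum_div]
      exact Finset.sum_congr rfl fun i _ => by split_ifs <;> simp [g]
    linarith
  have hmain := sum_mul_le_sum_mul_of_headSum_le (sing_antitone X) (sing_nonneg X) hg
  have hrhs : ∑ j : Fin n, sing X j * (if (j : ℕ) < m then d j else 0)
      = headSum (fun i => d i * sing X i) m :=
    Finset.sum_congr rfl fun i _ => by split_ifs <;> simp [mul_comm]
  rw [hrhs] at hmain
  refine le_trans ?_ hmain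
  rw [← headSum_castLE hm _ le_rfl, headSum_self]
  have hexp : ∀ l : Fin m, sing (C ⊙ X) (Fin.castLE hm l)
      = ∑ j, sing X j * bform C (u (e l) * p j) (v (e l) * q j) := by
    intro l
    rw [← huv]
    simp only [bform, hadamard_apply, hX, Finset.mul_sum, Finset.sum_mul]
    rw [Finset.sum_comm' (t' := univ) (s' := fun _ => univ) (by simp)]
    conv_rhs => rw [Finset.sum_comm]
    conv_rhs => enter [2, x]; rw [Finset.sum_comm]
    rw [Finset.sum_comm]
    refine Finset.sum_congr rfl fun i _ => Finset.sum_congr rfl fun j _ =>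
      Finset.sum_congr rfl fun k _ => ?_
    simp only [Pi.mul_apply, e, Fin.castLEEmb_apply]
    ring
  simp only [hexp]
  rw [Finset.sum_comm]
  refine Finset.sum_le_sum fun j _ => ?_
  rw [← Finset.mul_sum]
  refine mul_le_mul_of_nonneg_left ?_ (sing_nonneg X j)
  simp only [g, ← Finset.sum_add_distrib, Finset.sum_div]
  exact Finset.sum_le_sum fun l _ => bform_le_of_posSemidef hC _ _

/-! ### Eigenvalues, operator norm and Schur's diagonal inequality -/

theorem exists_eigenbasis {n : ℕ} {A : Matrix (Fin n) (Fin n) ℝ} (hA : A.IsHermitian) :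
    ∃ v : OrthonormalBasis (Fin n) ℝ (EuclideanSpace ℝ (Fin n)),
      ∀ l, Matrix.toEuclideanLin A (v l) = eigs hA l • v l := by
  have hT := isSymmetric_toEuclideanLin_iff.mpr hA
  have hdim : Module.finrank ℝ (EuclideanSpace ℝ (Fin n)) = n := finrank_euclideanSpace_fin
  -- `eigenvalues₀` is indexed through `Fintype.card (Fin n)`, so the eigenvalues must be
  -- transported to dimension n.
  have hcast : ∀ (m : ℕ) (hm : Module.finrank ℝ (EuclideanSpace ℝ (Fin n)) = m) (h : n = m)
      (l : Fin n), hT.eigenvalues hm (Fin.cast h l) = hT.eigenvalues hdim l := by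
    rintro m hm rfl l
    rfl
  refine ⟨hT.eigenvectorBasis hdim, fun l => ?_⟩
  rw [hT.apply_eigenvectorBasis hdim l]
  exact congrArg (fun c : ℝ => c • hT.eigenvectorBasis hdim l) (hcast _ _ _ l).symm

theorem eigs_antitone {n : ℕ} {A : Matrix (Fin n) (Fin n) ℝ} (hA : A.IsHermitian) :
    Antitone (eigs hA) := fun _ _ hij => hA.eigenvalues₀_antitone hij

theorem eigs_nonneg {n : ℕ} {A : Matrix (Fin n) (Fin n) ℝ} (hA : A.PosSemidef) (l : Fin n) :
    0 ≤ eigs hA.isHermitian l := by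
  obtain ⟨v, hv⟩ := exists_eigenbasis hA.isHermitian
  have h1 : inner ℝ (v l) (Matrix.toEuclideanLin A (v l)) = eigs hA.isHermitian l := by
    rw [hv, inner_smul_right]
    simp
  have h2 : inner ℝ (v l) (Matrix.toEuclideanLin A (v l)) = bform A (v l) (v l) := by
    rw [inner_eq_sum, bform_eq_dotProduct]
    simp [Matrix.toLpLin_apply, dotProduct]
  rw [← h1, h2]
  exact ((posSemidef_iff_bform A).mp hA).2 _

theorem abs_eigs_le_opNorm {n : ℕ} {A : Matrix (Fin n) (Fin n) ℝ} (hA : A.IsHermitian)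
    (l : Fin n) : |eigs hA l| ≤ opNorm A := by
  obtain ⟨v, hv⟩ := exists_eigenbasis hA
  have h := (Matrix.toEuclideanCLM (n := Fin n) (𝕜 := ℝ) A).le_opNorm (v l)
  have h2 : Matrix.toEuclideanCLM (n := Fin n) (𝕜 := ℝ) A (v l) = eigs hA l • v l := hv l
  rw [h2, norm_smul, v.orthonormal.1 l] at h
  simpa [opNorm] using h

theorem abs_apply_le_opNorm {n : ℕ} (A : Matrix (Fin n) (Fin n) ℝ) (i j : Fin n) :
    |A i j| ≤ opNorm A := by
  have h := (Matrix.toEuclideanCLM (n := Fin n) (𝕜 := ℝ) A).le_opNorm (EuclideanSpace.single j 1)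
  have h1 := PiLp.norm_apply_le
    (Matrix.toEuclideanCLM (n := Fin n) (𝕜 := ℝ) A (EuclideanSpace.single j 1)) i
  have h2 : Matrix.toEuclideanCLM (n := Fin n) (𝕜 := ℝ) A (EuclideanSpace.single j 1) i
      = A i j := by
    change Matrix.toEuclideanLin A (EuclideanSpace.single j (1 : ℝ)) i = A i j
    simp [Matrix.toLpLin_apply]
  rw [h2] at h1
  refine h1.trans (h.trans ?_)
  simp [opNorm]

/-- **Schur**: the diagonal of a positive semidefinite matrix is majorized by its spectrum. -/
theorem sum_diag_le_headSum_eigs {n : ℕ} {A : Matrix (Fin n) (Fin n) ℝ} (hA : A.PosSemidef)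
    (T : Finset (Fin n)) :
    ∑ i ∈ T, A i i ≤ headSum (eigs hA.isHermitian) T.card := by
  obtain ⟨v, hv⟩ := exists_eigenbasis hA.isHermitian
  have hb := isBessel_of_orthonormal v.orthonormal
  have h : ∑ i ∈ T, A i i = ∑ l, eigs hA.isHermitian l * ∑ i ∈ T, v l i ^ 2 := by
    simp only [Finset.mul_sum]
    rw [Finset.sum_comm]
    refine Finset.sum_congr rfl fun i _ => ?_
    rw [apply_eq_sum_of_apply_basis A v]
    refine Finset.sum_congr rfl fun l _ => ?_
    rw [hv]
    simp only [PiLp.smul_apply, smul_eq_mul]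
    ring
  rw [h]
  refine sum_mul_weight_le_headSum (eigs_antitone _) (eigs_nonneg hA)
    (fun l => Finset.sum_nonneg fun _ _ => sq_nonneg _) (fun l => ?_) ?_
  · exact (Finset.sum_le_univ_sum_of_nonneg fun _ => sq_nonneg _).trans (hb.sum_sq_le_one l)
  · rw [Finset.sum_comm]
    exact (Finset.sum_le_sum fun i _ => hb.sum_sq_apply_le_one i).trans (by simp)

/-! ### The interval (-α, α) -/

theorem mem_symInterval_of_abs_le {α : EReal} {x a : ℝ} (ha : a ∈ symInterval α)
    (h : |x| ≤ a) : x ∈ symInterval α := by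
  have h1 := abs_le.mp h
  refine ⟨?_, lt_of_le_of_lt (EReal.coe_le_coe_iff.mpr h1.2) ha.2⟩
  refine lt_of_lt_of_le (EReal.neg_lt_neg_iff.mpr ha.2) ?_
  rw [← EReal.coe_neg]
  exact EReal.coe_le_coe_iff.mpr h1.1

theorem abs_mem_symInterval {α : EReal} {x : ℝ} (hx : x ∈ symInterval α) :
    |x| ∈ symInterval α := by
  rcases abs_cases x with ⟨h, -⟩ | ⟨h, -⟩
  · rwa [h]
  · rw [h]
    refine ⟨?_, ?_⟩
    · rw [EReal.coe_neg]
      exact EReal.neg_lt_neg_iff.mpr hx.2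
    · rw [EReal.coe_neg]
      exact EReal.neg_lt_comm.mp hx.1

theorem mem_symInterval_of_mem_Icc {α : EReal} {x y z : ℝ} (hx : x ∈ symInterval α)
    (hy : y ∈ symInterval α) (h1 : x ≤ z) (h2 : z ≤ y) : z ∈ symInterval α :=
  ⟨hx.1.trans_le (EReal.coe_le_coe_iff.mpr h1), (EReal.coe_le_coe_iff.mpr h2).trans_lt hy.2⟩

theorem convex_symInterval (α : EReal) : Convex ℝ (symInterval α) :=
  Set.OrdConnected.convex ⟨fun _ hx _ hy _ hz => mem_symInterval_of_mem_Icc hx hy hz.1 hz.2⟩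

theorem exists_add_mem_symInterval {α : EReal} {x : ℝ} (hx : x ∈ symInterval α) :
    ∃ ρ > 0, x + ρ ∈ symInterval α := by
  obtain ⟨y, hxy, hy⟩ := EReal.lt_iff_exists_real_btwn.mp hx.2
  have hxy' : x < y := EReal.coe_lt_coe_iff.mp hxy
  refine ⟨y - x, sub_pos.mpr hxy', ?_⟩
  rw [add_sub_cancel]
  exact ⟨hx.1.trans hxy, hy⟩

theorem zero_mem_symInterval {α : EReal} (hα : 0 < α) : (0 : ℝ) ∈ symInterval α :=
  ⟨by simpa using EReal.neg_lt_neg_iff.mpr hα, by simpa using hα⟩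

/-- The nonnegative part of the interval `(-α, α)`. -/
def nonnegPart (α : EReal) : Set ℝ := {x | 0 ≤ x} ∩ symInterval α

theorem convex_nonnegPart (α : EReal) : Convex ℝ (nonnegPart α) :=
  (convex_Ici (0 : ℝ)).inter (convex_symInterval α)

/-! ### Entrywise positivity and the convexity defect -/

/-- The entrywise function `G` maps positive semidefinite `n × n` matrices with entries in
`[-a, a]` to positive semidefinite matrices. -/
def SPositiveOn (n : ℕ) (a : ℝ) (G : ℝ → ℝ) : Prop :=
  ∀ M : Matrix (Fin n) (Fin n) ℝ, M.PosSemidef → (∀ i j, |M i j| ≤ a) →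
    (entrywise G M).PosSemidef

theorem apply_comm_of_posSemidef {n : ℕ} {M : Matrix (Fin n) (Fin n) ℝ} (hM : M.PosSemidef)
    (i j : Fin n) : M i j = M j i := ((posSemidef_iff_bform M).mp hM).1.apply j i

/-- Positivity of G on the 2 × 2 matrix with diagonal b and off-diagonal x, tested on (1, 1) and (1,
-1). This is where n ≥ 2 enters. -/
theorem SPositiveOn.abs_apply_le {n : ℕ} (hn : 2 ≤ n) {a : ℝ} {G : ℝ → ℝ} (hG : SPositiveOn n a G)
    {x b : ℝ} (hx : |x| ≤ b) (hb : b ≤ a) : |G x| ≤ G b := by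
  have hb0 : 0 ≤ b := (abs_nonneg x).trans hx
  have hx' := abs_le.mp hx
  let i₀ : Fin n := ⟨0, by omega⟩
  let i₁ : Fin n := ⟨1, by omega⟩
  have hne : i₀ ≠ i₁ := by simp [i₀, i₁]
  let p : Fin n → ℝ := Pi.single i₀ 1 + Pi.single i₁ 1
  let q : Fin n → ℝ := Pi.single i₀ 1 - Pi.single i₁ 1
  -- The 2 × 2 block padded by zeros, written spectrally with eigenvalues b + x and b - x so that
  -- positivity is immediate.
  let M : Matrix (Fin n) (Fin n) ℝ :=
    ((b + x) / 2) • vecMulVec p p + ((b - x) / 2) • vecMulVec q q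
  have hM : M.PosSemidef := by
    have h1 := (posSemidef_vecMulVec_self_star p).smul (show (0 : ℝ) ≤ (b + x) / 2 by linarith)
    have h2 := (posSemidef_vecMulVec_self_star q).smul (show (0 : ℝ) ≤ (b - x) / 2 by linarith)
    simpa using h1.add h2
  have hMij : ∀ i j, M i j = (b + x) / 2 * (p i * p j) + (b - x) / 2 * (q i * q j) := by
    intro i j
    simp [M, vecMulVec_apply]
  have hp0 : p i₀ = 1 := by simp [p, hne]
  have hp1 : p i₁ = 1 := by simp [p, hne.symm]
  have hq0 : q i₀ = 1 := by simp [q, hne]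
  have hq1 : q i₁ = -1 := by simp [q, hne.symm]
  have hcase : ∀ i, (p i = 1 ∧ q i = 1) ∨ (p i = 1 ∧ q i = -1) ∨ (p i = 0 ∧ q i = 0) := by
    intro i
    by_cases h0 : i = i₀
    · subst h0; exact Or.inl ⟨hp0, hq0⟩
    · by_cases h1 : i = i₁
      · subst h1; exact Or.inr (Or.inl ⟨hp1, hq1⟩)
      · exact Or.inr (Or.inr ⟨by simp [p, h0, h1], by simp [q, h0, h1]⟩)
  have hbd : ∀ i j, |M i j| ≤ a := by
    intro i j
    rw [hMij, abs_le]
    rcases hcase i with ⟨h1, h2⟩ | ⟨h1, h2⟩ | ⟨h1, h2⟩ <;>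
    rcases hcase j with ⟨h3, h4⟩ | ⟨h3, h4⟩ | ⟨h3, h4⟩ <;>
    rw [h1, h2, h3, h4] <;> constructor <;> linarith
  have hE := ((posSemidef_iff_bform _).mp (hG M hM hbd)).2
  have hform : ∀ c : ℝ, bform (entrywise G M) (Pi.single i₀ 1 + Pi.single i₁ c)
      (Pi.single i₀ 1 + Pi.single i₁ c) = G b + c * G x + c * G x + c * c * G b := by
    intro c
    have h00 : M i₀ i₀ = b := by rw [hMij, hp0, hq0]; ring
    have h01 : M i₀ i₁ = x := by rw [hMij, hp0, hq0, hp1, hq1]; ring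
    have h10 : M i₁ i₀ = x := by rw [hMij, hp0, hq0, hp1, hq1]; ring
    have h11 : M i₁ i₁ = b := by rw [hMij, hp1, hq1]; ring
    rw [bform_eq_dotProduct]
    simp only [mulVec_add, dotProduct_add, add_dotProduct, mulVec_single, single_dotProduct,
      entrywise, of_apply, col_apply, Pi.smul_apply, MulOpposite.smul_eq_mul_unop,
      MulOpposite.unop_op, h00, h01, h10, h11]
    ring
  have h1 := hE (Pi.single i₀ 1 + Pi.single i₁ 1)
  have h2 := hE (Pi.single i₀ 1 + Pi.single i₁ (-1))
  rw [hform] at h1 h2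
  rw [abs_le]
  constructor <;> linarith

/-- The convexity defect of `f` on the segment from `x` to `x + h`. -/
def defect (f : ℝ → ℝ) (h t x : ℝ) : ℝ := t * f (x + h) + (1 - t) * f x - f (x + t * h)

/-- S-convexity for the pair M + hJ ≥ M ≥ 0, with J the all-ones matrix. -/
theorem SConvexOfOrder.sPositiveOn_defect {n : ℕ} {α : EReal} {f : ℝ → ℝ}
    (hf : SConvexOfOrder n α f) {a h t : ℝ} (hh : 0 ≤ h) (hah : a + h ∈ symInterval α)
    (ht0 : 0 ≤ t) (ht1 : t ≤ 1) : SPositiveOn n a (defect f h t) := by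
  intro M hM hMa
  have hJ : (Matrix.of fun _ _ : Fin n => h).PosSemidef := by
    have := (posSemidef_vecMulVec_self_star (fun _ : Fin n => (1 : ℝ))).smul hh
    convert! this using 1
    ext i j
    simp [vecMulVec_apply]
  have hMs : M.IsSymm := ((posSemidef_iff_bform M).mp hM).1
  have hMI : ∀ i j, M i j ∈ symInterval α := fun i j =>
    mem_symInterval_of_abs_le hah ((hMa i j).trans (by linarith))
  have key := hf (M + Matrix.of fun _ _ => h) M
    (hMs.add (((posSemidef_iff_bform _).mp hJ).1)) hMs
    (fun i j => mem_symInterval_of_abs_le hah (by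
      have := abs_le.mp (hMa i j)
      rw [Matrix.add_apply, of_apply, abs_le]
      constructor <;> linarith)) hMI (by simpa using hJ) hM t ht0 ht1
  convert! key using 1
  ext i j
  simp only [entrywise, of_apply, defect, Matrix.sub_apply, Matrix.add_apply, Matrix.smul_apply,
    smul_eq_mul]
  congr 2
  ring

section

variable {n : ℕ} {α : EReal} {f : ℝ → ℝ}

/-- The source of all regularity: on the nonnegative side the defect is nonnegative and
nondecreasing in the base point, and there it dominates the defect at negative points. -/
theorem SConvexOfOrder.abs_defect_le (hn : 2 ≤ n) (hf : SConvexOfOrder n α f) {a x h t : ℝ}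
    (hx : |x| ≤ a) (hh : 0 ≤ h) (hah : a + h ∈ symInterval α) (ht0 : 0 ≤ t) (ht1 : t ≤ 1) :
    |defect f h t x| ≤ defect f h t a :=
  (hf.sPositiveOn_defect hh hah ht0 ht1).abs_apply_le hn hx le_rfl

/-- Convexity in terms of the defect. -/
theorem convexOn_of_defect_nonneg {D : Set ℝ} (hD : Convex ℝ D)
    (h : ∀ x ∈ D, ∀ h ≥ 0, x + h ∈ D → ∀ t, 0 ≤ t → t ≤ 1 → 0 ≤ defect f h t x) :
    ConvexOn ℝ D f := by
  refine LinearOrder.convexOn_of_lt hD fun x hx y hy hxy a b ha hb hab => ?_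
  have := h x hx (y - x) (sub_nonneg.mpr hxy.le) (by simpa using hy) b hb.le (by linarith)
  obtain rfl : a = 1 - b := by linarith
  simp only [defect, add_sub_cancel] at this
  simp only [smul_eq_mul]
  rw [show (1 - b) * x + b * y = x + b * (y - x) by ring]
  linarith

theorem SConvexOfOrder.convexOn_nonnegPart (hn : 2 ≤ n) (hf : SConvexOfOrder n α f) :
    ConvexOn ℝ (nonnegPart α) f :=
  convexOn_of_defect_nonneg (convex_nonnegPart α) fun _ hx _ hh hxh _ ht0 ht1 =>
    (abs_nonneg _).trans (hf.abs_defect_le hn (abs_of_nonneg hx.1).le hh hxh.2 ht0 ht1)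

theorem defect_sub (g₁ g₂ : ℝ → ℝ) (h t x : ℝ) :
    defect (fun y => g₁ y - g₂ y) h t x = defect g₁ h t x - defect g₂ h t x := by
  simp only [defect]; ring

theorem defect_mul_sq (K h t x : ℝ) :
    defect (fun y => K * y ^ 2) h t x = K * (t * (1 - t) * h ^ 2) := by
  simp only [defect]; ring

theorem defect_nonneg_of_convexOn {D : Set ℝ} (hf : ConvexOn ℝ D f) {x h t : ℝ} (hx : x ∈ D)
    (hxh : x + h ∈ D) (ht0 : 0 ≤ t) (ht1 : t ≤ 1) : 0 ≤ defect f h t x := by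
  have := hf.2 hx hxh (sub_nonneg.mpr ht1) ht0 (by ring)
  simp only [smul_eq_mul] at this
  rw [show (1 - t) * x + t * (x + h) = x + t * h by ring] at this
  simp only [defect]
  linarith

theorem le_of_hasDerivAt_nonneg {g g' : ℝ → ℝ} {a b : ℝ} (hab : a ≤ b)
    (hg : ∀ x ∈ Set.Icc a b, HasDerivAt g (g' x) x) (hg' : ∀ x ∈ Set.Icc a b, 0 ≤ g' x) :
    g a ≤ g b :=
  monotoneOn_of_deriv_nonneg (convex_Icc a b)
    (fun x hx => (hg x hx).continuousAt.continuousWithinAt)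
    (fun x hx => (hg x (interior_subset hx)).differentiableAt.differentiableWithinAt)
    (fun x hx => by
      rw [(hg x (interior_subset hx)).deriv]
      exact hg' x (interior_subset hx))
    (Set.left_mem_Icc.mpr hab) (Set.right_mem_Icc.mpr hab) hab

/-! ### Continuous differentiability -/

/-- Quadratic bound for the convexity defect of a convex function whose defect is monotone. -/
theorem SConvexOfOrder.exists_defect_le (hn : 2 ≤ n) (hf : SConvexOfOrder n α f) {a ρ : ℝ}
    (ha : 0 < a) (hρ : 0 < ρ) (haρ : a + 2 * ρ ∈ symInterval α) :
    ∃ K, ∀ h t, 0 ≤ h → h ≤ ρ → 0 ≤ t → t ≤ 1 →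
      defect f h t a ≤ K * (t * (1 - t) * h ^ 2) := by
  have hconv := hf.convexOn_nonnegPart hn
  obtain ⟨ε, hε, haε⟩ := exists_add_mem_symInterval haρ
  have hsub : Set.Ioo 0 (a + 2 * ρ + ε) ⊆ nonnegPart α := fun x hx =>
    ⟨hx.1.le, mem_symInterval_of_abs_le haε (by rw [abs_of_pos hx.1]; linarith [hx.2])⟩
  have hconv' : ConvexOn ℝ (Set.Ioo 0 (a + 2 * ρ + ε)) f :=
    hconv.subset hsub (convex_Ioo _ _)
  have hcont : ContinuousOn f (Set.Ioo 0 (a + 2 * ρ + ε)) :=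
    hconv'.continuousOn isOpen_Ioo
  have hIcc : ∀ x ∈ Set.Icc a (a + 2 * ρ), x ∈ Set.Ioo 0 (a + 2 * ρ + ε) := fun x hx =>
    ⟨ha.trans_le hx.1, by linarith [hx.2]⟩
  obtain ⟨Lc, hLc⟩ : ∃ Lc : ℝ, ∀ x ∈ Set.Icc a (a + 2 * ρ), ∀ y ∈ Set.Icc a (a + 2 * ρ),
      x ≤ y → |f y - f x| ≤ Lc * (y - x) := by
    have hl : LocallyLipschitzOn (Set.Icc a (a + 2 * ρ)) f :=
      (hconv'.locallyLipschitzOn isOpen_Ioo).mono fun x hx => hIcc x hx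
    obtain ⟨Lc, hL⟩ := hl.exists_lipschitzOnWith_of_compact isCompact_Icc
    refine ⟨Lc, fun x hx y hy hxy => ?_⟩
    have := hL.dist_le_mul y hy x hx
    rwa [Real.dist_eq, Real.dist_eq, abs_of_nonneg (sub_nonneg.mpr hxy)] at this
  let G : ℝ → ℝ := fun x => ∫ s in a..x, f s
  have hG : ∀ x ∈ Set.Icc a (a + 2 * ρ), HasDerivAt G (f x) x := by
    intro x hx
    refine intervalIntegral.integral_hasDerivAt_right ?_
      (hcont.stronglyMeasurableAtFilter isOpen_Ioo x (hIcc x hx))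
      (hcont.continuousAt (isOpen_Ioo.mem_nhds (hIcc x hx)))
    refine (hcont.mono fun y hy => hIcc y ?_).intervalIntegrable
    rw [Set.uIcc_of_le hx.1] at hy
    exact ⟨hy.1, hy.2.trans hx.2⟩
  -- F is the integral of f over [x, x + ρ]. Its derivative is 2Lc-Lipschitz because f is
  -- Lc-Lipschitz, so Lc x² - F is convex.
  let F : ℝ → ℝ := fun x => G (x + ρ) - G x
  have hF : ∀ x ∈ Set.Icc a (a + ρ), HasDerivAt F (f (x + ρ) - f x) x := by
    intro x hx
    exact ((hG (x + ρ) ⟨by linarith [hx.1], by linarith [hx.2]⟩).comp_add_const x ρ).sub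
      (hG x ⟨hx.1, by linarith [hx.2]⟩)
  have hquad : ∀ x ∈ Set.Icc a (a + ρ),
      HasDerivAt (fun x => Lc * x ^ 2 - F x) (Lc * (2 * x) - (f (x + ρ) - f x)) x := by
    intro x hx
    have h1 : HasDerivAt (fun x : ℝ => Lc * x ^ 2) (Lc * (2 * x)) x := by
      simpa using (hasDerivAt_pow 2 x).const_mul Lc
    exact h1.sub (hF x hx)
  have hGc : ConvexOn ℝ (Set.Icc a (a + ρ)) fun x => Lc * x ^ 2 - F x := by
    refine MonotoneOn.convexOn_of_deriv (convex_Icc _ _)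
      (fun x hx => (hquad x hx).continuousAt.continuousWithinAt)
      (fun x hx => (hquad x (interior_subset hx)).differentiableAt.differentiableWithinAt) ?_
    intro x hx y hy hxy
    have hx := interior_subset hx
    have hy := interior_subset hy
    rw [(hquad x hx).deriv, (hquad y hy).deriv]
    have h1 := hLc x ⟨hx.1, by linarith [hx.2]⟩ y ⟨hy.1, by linarith [hy.2]⟩ hxy
    have h2 := hLc (x + ρ) ⟨by linarith [hx.1], by linarith [hx.2]⟩ (y + ρ)
      ⟨by linarith [hy.1], by linarith [hy.2]⟩ (by linarith)
    have h3 := (abs_le.mp h1).1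
    have h4 := (abs_le.mp h2).2
    linarith
  refine ⟨Lc / ρ, fun h t hh hhρ ht0 ht1 => ?_⟩
  have h1 := defect_nonneg_of_convexOn hGc (x := a) (h := h) ⟨le_rfl, by linarith⟩
    ⟨by linarith, by linarith⟩ ht0 ht1
  rw [defect_sub, defect_mul_sq] at h1
  -- The right side is the integral of the defect of f over base points in [a, a + ρ], each at least
  -- the defect at a.
  have h2 : ρ * defect f h t a ≤ defect F h t a := by
    have hW := le_of_hasDerivAt_nonneg (g := fun x => defect G h t x - x * defect f h t a)
      (g' := fun x => defect f h t x - 1 * defect f h t a) (a := a) (b := a + ρ) (by linarith)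
      (fun x hx => ?_) fun x hx => ?_
    · have : defect F h t a = defect G h t (a + ρ) - defect G h t a := by
        simp only [F, defect]
        rw [show a + h + ρ = a + ρ + h by ring, show a + t * h + ρ = a + ρ + t * h by ring]
        ring
      rw [this]
      linarith
    · have hth : t * h ≤ h := mul_le_of_le_one_left hh ht1
      have hth0 : 0 ≤ t * h := mul_nonneg ht0 hh
      have d1 := (hG (x + h) ⟨by linarith [hx.1], by linarith [hx.2]⟩).comp_add_const x h
      have d2 := hG x ⟨hx.1, by linarith [hx.2]⟩
      have d3 := (hG (x + t * h) ⟨by linarith [hx.1], by linarith [hx.2]⟩).comp_add_const x (t * h)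
      exact (((d1.const_mul t).add (d2.const_mul (1 - t))).sub d3).sub
        ((hasDerivAt_id x).mul_const _)
    · have hx0 : 0 < x := ha.trans_le hx.1
      have := (le_abs_self _).trans (hf.abs_defect_le hn (a := x) (x := a) (h := h) (t := t)
        (by rw [abs_of_pos ha]; exact hx.1) hh
        (mem_symInterval_of_abs_le haρ
          (by rw [abs_of_pos (by linarith)]; linarith [hx.2])) ht0 ht1)
      linarith
  rw [div_mul_eq_mul_div, le_div_iff₀ hρ]
  linarith

theorem differentiableAt_of_convexOn {S : Set ℝ} {K : ℝ} (h₁ : ConvexOn ℝ S fun y => K * y ^ 2 - f y)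
    (h₂ : ConvexOn ℝ S fun y => K * y ^ 2 + f y) {x : ℝ} (hx : x ∈ interior S) :
    DifferentiableAt ℝ f x := by
  have r1 := h₁.hasDerivWithinAt_rightDeriv_of_mem_interior hx
  have r2 := h₂.hasDerivWithinAt_rightDeriv_of_mem_interior hx
  have l1 := h₁.hasDerivWithinAt_leftDeriv_of_mem_interior hx
  have l2 := h₂.hasDerivWithinAt_leftDeriv_of_mem_interior hx
  have le1 := h₁.leftDeriv_le_rightDeriv_of_mem_interior hx
  have le2 := h₂.leftDeriv_le_rightDeriv_of_mem_interior hx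
  set R1 := derivWithin (fun y => K * y ^ 2 - f y) (Set.Ioi x) x
  set R2 := derivWithin (fun y => K * y ^ 2 + f y) (Set.Ioi x) x
  set L1 := derivWithin (fun y => K * y ^ 2 - f y) (Set.Iio x) x
  set L2 := derivWithin (fun y => K * y ^ 2 + f y) (Set.Iio x) x
  have hsum : (fun y => (K * y ^ 2 - f y) + (K * y ^ 2 + f y)) = fun y => 2 * K * y ^ 2 := by
    funext y; ring
  have hq : HasDerivAt (fun y : ℝ => 2 * K * y ^ 2) (2 * K * (2 * x)) x := by
    simpa using (hasDerivAt_pow 2 x).const_mul (2 * K)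
  have hr : R1 + R2 = 2 * K * (2 * x) := by
    have := r1.add r2
    rw [show ((fun y => K * y ^ 2 - f y) + fun y => K * y ^ 2 + f y)
      = fun y => 2 * K * y ^ 2 from hsum] at this
    exact (uniqueDiffWithinAt_Ioi x).eq_deriv _ this hq.hasDerivWithinAt
  have hl : L1 + L2 = 2 * K * (2 * x) := by
    have := l1.add l2
    rw [show ((fun y => K * y ^ 2 - f y) + fun y => K * y ^ 2 + f y)
      = fun y => 2 * K * y ^ 2 from hsum] at this
    exact (uniqueDiffWithinAt_Iio x).eq_deriv _ this hq.hasDerivWithinAt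
  -- L1 ≤ R1 and L2 ≤ R2 by convexity, while L1 + L2 = R1 + R2 because the sum of the two functions
  -- is smooth.
  have e2 : L2 = R2 := by linarith
  rw [e2] at l2
  have hd : HasDerivAt (fun y => K * y ^ 2 + f y) R2 x := by
    have := (hasDerivWithinAt_Iio_iff_Iic.mp l2).union (hasDerivWithinAt_Ioi_iff_Ici.mp r2)
    rwa [Set.Iic_union_Ici, hasDerivWithinAt_univ] at this
  have hK : HasDerivAt (fun y : ℝ => K * y ^ 2) (K * (2 * x)) x := by
    simpa using (hasDerivAt_pow 2 x).const_mul K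
  have := hd.sub hK
  rw [show ((fun y => K * y ^ 2 + f y) - fun y => K * y ^ 2) = f by
    funext y; simp] at this
  exact this.differentiableAt

/-- Both 2Ky - f' and 2Ky + f' are nondecreasing, so f' is Lipschitz near x. -/
theorem continuousAt_deriv_of_convexOn {S : Set ℝ} {K : ℝ}
    (h₁ : ConvexOn ℝ S fun y => K * y ^ 2 - f y) (h₂ : ConvexOn ℝ S fun y => K * y ^ 2 + f y)
    {x : ℝ} (hx : x ∈ interior S) : ContinuousAt (deriv f) x := by
  have hd : ∀ y ∈ interior S, DifferentiableAt ℝ f y := fun y hy => differentiableAt_of_convexOn h₁ h₂ hy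
  have hK : ∀ y : ℝ, HasDerivAt (fun y : ℝ => K * y ^ 2) (K * (2 * y)) y := fun y => by
    simpa using (hasDerivAt_pow 2 y).const_mul K
  have d1 : ∀ y ∈ interior S, HasDerivAt (fun y => K * y ^ 2 - f y) (K * (2 * y) - deriv f y) y :=
    fun y hy => (hK y).sub (hd y hy).hasDerivAt
  have d2 : ∀ y ∈ interior S, HasDerivAt (fun y => K * y ^ 2 + f y) (K * (2 * y) + deriv f y) y :=
    fun y hy => (hK y).add (hd y hy).hasDerivAt
  have m1 := (h₁.subset interior_subset h₁.1.interior).monotoneOn_deriv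
    fun y hy => (d1 y hy).differentiableAt
  have m2 := (h₂.subset interior_subset h₁.1.interior).monotoneOn_deriv
    fun y hy => (d2 y hy).differentiableAt
  have hle : ∀ y ∈ interior S, |deriv f y - deriv f x| ≤ 2 * |K| * |y - x| := by
    intro y hy
    have hKK : |K * (2 * y) - K * (2 * x)| = 2 * |K| * |y - x| := by
      rw [show K * (2 * y) - K * (2 * x) = 2 * K * (y - x) by ring, abs_mul, abs_mul, abs_two]
    rw [← hKK]
    rcases le_total x y with h | h
    · have a1 := m1 hx hy h
      have a2 := m2 hx hy h
      rw [(d1 x hx).deriv, (d1 y hy).deriv] at a1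
      rw [(d2 x hx).deriv, (d2 y hy).deriv] at a2
      refine le_trans ?_ (le_abs_self _)
      rw [abs_le]
      constructor <;> linarith
    · have a1 := m1 hy hx h
      have a2 := m2 hy hx h
      rw [(d1 x hx).deriv, (d1 y hy).deriv] at a1
      rw [(d2 x hx).deriv, (d2 y hy).deriv] at a2
      refine le_trans ?_ (neg_le_abs _)
      rw [abs_le]
      constructor <;> linarith
  rw [ContinuousAt, tendsto_iff_norm_sub_tendsto_zero]
  refine squeeze_zero' (Eventually.of_forall fun _ => norm_nonneg _)
    ((isOpen_interior.eventually_mem hx).mono fun y hy => hle y hy) ?_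
  have hc : Continuous fun y : ℝ => 2 * |K| * |y - x| := by fun_prop
  simpa using hc.tendsto x

theorem SConvexOfOrder.exists_convexOn (hn : 2 ≤ n) (hf : SConvexOfOrder n α f) {x : ℝ}
    (hx : x ∈ symInterval α) : ∃ (S : Set ℝ) (K : ℝ), x ∈ interior S ∧
      (ConvexOn ℝ S fun y => K * y ^ 2 - f y) ∧ ConvexOn ℝ S fun y => K * y ^ 2 + f y := by
  obtain ⟨ρ', hρ', hxρ'⟩ := exists_add_mem_symInterval (abs_mem_symInterval hx)
  -- Base points within ρ of x have modulus at most |x| + ρ, steps have length at most 2ρ, and the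
  -- quadratic bound needs twice that beyond |x| + ρ: in total 5ρ.
  obtain ⟨ρ, rfl⟩ : ∃ ρ, ρ' = 5 * ρ := ⟨ρ' / 5, by ring⟩
  have hρ : 0 < ρ := by linarith
  have hx0 := abs_nonneg x
  obtain ⟨K, hK⟩ := hf.exists_defect_le hn (a := |x| + ρ) (ρ := 2 * ρ) (by linarith)
    (by linarith) (by rwa [show |x| + ρ + 2 * (2 * ρ) = |x| + 5 * ρ by ring])
  have key : ∀ y ∈ Set.Icc (x - ρ) (x + ρ), ∀ h ≥ 0, y + h ∈ Set.Icc (x - ρ) (x + ρ) →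
      ∀ t, 0 ≤ t → t ≤ 1 → |defect f h t y| ≤ K * (t * (1 - t) * h ^ 2) := by
    intro y hy h hh hyh t ht0 ht1
    have h2 : h ≤ 2 * ρ := by linarith [hy.1, hyh.2]
    refine le_trans (hf.abs_defect_le hn (a := |x| + ρ) ?_ hh ?_ ht0 ht1) (hK h t hh h2 ht0 ht1)
    · rw [abs_le]
      constructor <;> linarith [hy.1, hy.2, neg_abs_le x, le_abs_self x]
    · exact mem_symInterval_of_abs_le hxρ' (by rw [abs_of_nonneg (by linarith)]; linarith)
  refine ⟨Set.Icc (x - ρ) (x + ρ), K, ?_, ?_, ?_⟩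
  · rw [interior_Icc]
    constructor <;> linarith
  · refine convexOn_of_defect_nonneg (convex_Icc _ _) fun y hy h hh hyh t ht0 ht1 => ?_
    rw [defect_sub, defect_mul_sq]
    linarith [(abs_le.mp (key y hy h hh hyh t ht0 ht1)).2]
  · refine convexOn_of_defect_nonneg (convex_Icc _ _) fun y hy h hh hyh t ht0 ht1 => ?_
    have : defect (fun y => K * y ^ 2 + f y) h t y
        = K * (t * (1 - t) * h ^ 2) + defect f h t y := by
      simp only [defect]; ring
    rw [this]
    linarith [(abs_le.mp (key y hy h hh hyh t ht0 ht1)).1]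

theorem SConvexOfOrder.differentiableAt (hn : 2 ≤ n) (hf : SConvexOfOrder n α f) {x : ℝ}
    (hx : x ∈ symInterval α) : DifferentiableAt ℝ f x := by
  obtain ⟨S, K, hxS, h₁, h₂⟩ := hf.exists_convexOn hn hx
  exact differentiableAt_of_convexOn h₁ h₂ hxS

theorem SConvexOfOrder.continuousOn_deriv (hn : 2 ≤ n) (hf : SConvexOfOrder n α f) :
    ContinuousOn (deriv f) (symInterval α) := fun x hx => by
  obtain ⟨S, K, hxS, h₁, h₂⟩ := hf.exists_convexOn hn hx
  exact (continuousAt_deriv_of_convexOn h₁ h₂ hxS).continuousWithinAt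

/-! ### Positivity, monotonicity and convexity of the derivative -/

theorem nonneg_of_hasDerivAt_of_eventually_le {q : ℝ → ℝ} {q' x : ℝ} (hq : HasDerivAt q q' x)
    (h : ∀ᶠ y in 𝓝[>] x, q x ≤ q y) : 0 ≤ q' := by
  have ht := (hasDerivWithinAt_iff_tendsto_slope' (s := Set.Ioi x) (by simp)).mp
    hq.hasDerivWithinAt
  refine ge_of_tendsto ht ?_
  filter_upwards [h, self_mem_nhdsWithin] with y hy hxy
  rw [slope_def_field]
  exact div_nonneg (sub_nonneg.mpr hy) (sub_nonneg.mpr (le_of_lt hxy))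

theorem bform_entrywise_hasDerivAt {g : Fin n → Fin n → ℝ → ℝ} {g' : Fin n → Fin n → ℝ} {t : ℝ}
    (hg : ∀ i j, HasDerivAt (g i j) (g' i j) t) (z : Fin n → ℝ) :
    HasDerivAt (fun s => bform (Matrix.of fun i j => g i j s) z z)
      (bform (Matrix.of g') z z) t := by
  simp only [bform, of_apply]
  exact HasDerivAt.fun_sum fun i _ => HasDerivAt.fun_sum fun j _ =>
    ((hg i j).const_mul (z i)).mul_const (z j)

theorem posSemidef_of_bform {M : Matrix (Fin n) (Fin n) ℝ} (hM : M.PosSemidef) {g : ℝ → ℝ}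
    (h : ∀ z, 0 ≤ bform (entrywise g M) z z) : (entrywise g M).PosSemidef := by
  rw [posSemidef_iff_bform]
  refine ⟨?_, h⟩
  ext i j
  simp only [transpose_apply, entrywise, of_apply]
  rw [apply_comm_of_posSemidef hM]

theorem add_mem_symInterval_of_abs_le {a h x : ℝ} (hh : 0 ≤ h) (hah : a + h ∈ symInterval α)
    (hx : |x| ≤ a) : x + h ∈ symInterval α :=
  mem_symInterval_of_abs_le hah ((abs_add_le x h).trans (by rw [abs_of_nonneg hh]; linarith))

theorem SConvexOfOrder.sPositiveOn_deriv_sub (hn : 2 ≤ n) (hf : SConvexOfOrder n α f) {a h : ℝ}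
    (hh : 0 ≤ h) (hah : a + h ∈ symInterval α) :
    SPositiveOn n a fun x => h * (deriv f (x + h) - deriv f x) := by
  intro M hM hMa
  refine posSemidef_of_bform hM fun z => ?_
  -- Adding the defects at t and 1 - t cancels the chord, so the slope at t = 0 involves only the
  -- derivatives at the two endpoints.
  have hd : ∀ i j, HasDerivAt (fun t => defect f h t (M i j) + defect f h (1 - t) (M i j))
      (h * (deriv f (M i j + h) - deriv f (M i j))) 0 := by
    intro i j
    have hfun : (fun t => defect f h t (M i j) + defect f h (1 - t) (M i j)) = fun t =>
        f (M i j + h) + f (M i j) - f (M i j + t * h) - f (M i j + (1 - t) * h) := by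
      funext t
      simp only [defect]; ring
    have l1 : HasDerivAt (fun t : ℝ => M i j + t * h) h 0 := by
      simpa using ((hasDerivAt_id (0 : ℝ)).mul_const h).const_add (M i j)
    have l2 : HasDerivAt (fun t : ℝ => M i j + (1 - t) * h) (-h) 0 := by
      simpa using (((hasDerivAt_id (0 : ℝ)).const_sub 1).mul_const h).const_add (M i j)
    have f1 : HasDerivAt f (deriv f (M i j)) (M i j + 0 * h) := by
      simpa using (hf.differentiableAt hn
        (mem_symInterval_of_abs_le hah ((hMa i j).trans (by linarith)))).hasDerivAt
    have f2 : HasDerivAt f (deriv f (M i j + h)) (M i j + (1 - 0) * h) := by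
      simpa using (hf.differentiableAt hn (add_mem_symInterval_of_abs_le hh hah (hMa i j))).hasDerivAt
    rw [hfun]
    convert! ((f1.comp (0 : ℝ) l1).const_sub (f (M i j + h) + f (M i j))).sub
      (f2.comp (0 : ℝ) l2) using 1
    ring
  refine nonneg_of_hasDerivAt_of_eventually_le (bform_entrywise_hasDerivAt hd z) ?_
  filter_upwards [Ioo_mem_nhdsGT (zero_lt_one (α := ℝ))] with t ht
  have h1 := ((posSemidef_iff_bform _).mp
    (hf.sPositiveOn_defect hh hah ht.1.le ht.2.le M hM hMa)).2 z
  have h2 := ((posSemidef_iff_bform _).mp (hf.sPositiveOn_defect (t := 1 - t) hh hah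
    (by linarith [ht.2]) (by linarith [ht.1]) M hM hMa)).2 z
  have h3 : bform (Matrix.of fun i j => defect f h t (M i j) + defect f h (1 - t) (M i j)) z z
      = bform (entrywise (defect f h t) M) z z + bform (entrywise (defect f h (1 - t)) M) z z := by
    simp only [bform, ← Finset.sum_add_distrib, of_apply, entrywise]
    exact Finset.sum_congr rfl fun i _ => Finset.sum_congr rfl fun j _ => by ring
  have h4 : bform (Matrix.of fun i j => defect f h 0 (M i j) + defect f h (1 - 0) (M i j)) z z
      = 0 := by
    simp [bform, defect]
  rw [h3, h4]
  exact add_nonneg h1 h2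

/-- Along tM the derivative of the increment matrix is f'[tM + hJ] - f'[tM], J all ones,
Hadamard-multiplied by M; it is positive semidefinite by the Schur product theorem. Integration
starts at t = 0, where the matrix is constant. -/
theorem SConvexOfOrder.bform_increment_nonneg (hn : 2 ≤ n) (hf : SConvexOfOrder n α f) {a h : ℝ}
    (hh : 0 < h) (hah : a + h ∈ symInterval α) {M : Matrix (Fin n) (Fin n) ℝ}
    (hM : M.PosSemidef) (hMa : ∀ i j, |M i j| ≤ a) (z : Fin n → ℝ) :
    bform (Matrix.of fun _ _ => f h - f 0) z z
      ≤ bform (entrywise (fun x => f (x + h) - f x) M) z z := by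
  have habs : ∀ t ∈ Set.Icc (0 : ℝ) 1, ∀ i j, |t * M i j| ≤ a := by
    intro t ht i j
    rw [abs_mul, abs_of_nonneg ht.1]
    exact (mul_le_of_le_one_left (abs_nonneg _) ht.2).trans (hMa i j)
  have h01 := le_of_hasDerivAt_nonneg (zero_le_one (α := ℝ))
    (g := fun t => bform (Matrix.of fun i j => f (t * M i j + h) - f (t * M i j)) z z)
    (g' := fun t => bform (Matrix.of fun i j =>
      (deriv f (t * M i j + h) - deriv f (t * M i j)) * M i j) z z) ?_ ?_
  · simpa [entrywise] using h01
  · intro t ht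
    refine bform_entrywise_hasDerivAt (g := fun i j t => f (t * M i j + h) - f (t * M i j))
      (fun i j => ?_) z
    have l1 : HasDerivAt (fun t : ℝ => t * M i j) (M i j) t := by
      simpa using (hasDerivAt_id t).mul_const (M i j)
    have f1 : HasDerivAt f (deriv f (t * M i j)) (t * M i j) := (hf.differentiableAt hn
      (mem_symInterval_of_abs_le hah ((habs t ht i j).trans (by linarith)))).hasDerivAt
    have f2 : HasDerivAt f (deriv f (t * M i j + h)) (t * M i j + h) :=
      (hf.differentiableAt hn (add_mem_symInterval_of_abs_le hh.le hah (habs t ht i j))).hasDerivAt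
    have := (f2.comp t (l1.add_const h)).sub (f1.comp t l1)
    rw [← sub_mul] at this
    exact this
  · intro t ht
    have hp := (hf.sPositiveOn_deriv_sub hn hh.le hah (t • M) (hM.smul ht.1)
      (fun i j => by simpa using habs t ht i j)).hadamard hM
    have := ((posSemidef_iff_bform _).mp hp).2 z
    have he : bform (entrywise (fun x => h * (deriv f (x + h) - deriv f x)) (t • M) ⊙ M) z z
        = h * bform (Matrix.of fun i j =>
          (deriv f (t * M i j + h) - deriv f (t * M i j)) * M i j) z z := by
      simp only [bform, Finset.mul_sum, hadamard_apply, entrywise, of_apply, Matrix.smul_apply,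
        smul_eq_mul]
      exact Finset.sum_congr rfl fun i _ => Finset.sum_congr rfl fun j _ => by ring
    rw [he] at this
    exact nonneg_of_mul_nonneg_right this hh

theorem bform_const (c : ℝ) (z : Fin n → ℝ) :
    bform (Matrix.of fun _ _ => c) z z = c * (∑ i, z i) ^ 2 := by
  rw [sq, Finset.sum_mul_sum]
  simp only [bform, of_apply, Finset.mul_sum]
  exact Finset.sum_congr rfl fun i _ => Finset.sum_congr rfl fun j _ => by ring

/-- The derivative of an S-convex function with `f'(0) ≥ 0` preserves positivity entrywise. -/
theorem SConvexOfOrder.sPositiveOn_deriv (hn : 2 ≤ n) (hf : SConvexOfOrder n α f)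
    (hf0 : 0 ≤ deriv f 0) {a : ℝ} (ha : a ∈ symInterval α) : SPositiveOn n a (deriv f) := by
  intro M hM hMa
  refine posSemidef_of_bform hM fun z => ?_
  have ha0 : 0 ≤ a := (abs_nonneg _).trans (hMa ⟨0, by omega⟩ ⟨0, by omega⟩)
  have h0 : (0 : ℝ) ∈ symInterval α := mem_symInterval_of_abs_le ha (by simpa using ha0)
  have hd : ∀ i j, HasDerivAt (fun h => f (M i j + h) - f (0 + h))
      (deriv f (M i j) - deriv f 0) 0 := by
    intro i j
    have f1 : HasDerivAt f (deriv f (M i j)) (M i j + 0) := by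
      simpa using (hf.differentiableAt hn (mem_symInterval_of_abs_le ha (hMa i j))).hasDerivAt
    have f2 : HasDerivAt f (deriv f 0) (0 + 0) := by
      simpa using (hf.differentiableAt hn h0).hasDerivAt
    exact (f1.comp_const_add (M i j) 0).sub (f2.comp_const_add 0 0)
  -- The increment inequality says that the form of f(M + h) - f(h) is at least its value at h = 0,
  -- so its right slope there is nonnegative.
  have hnn := nonneg_of_hasDerivAt_of_eventually_le (bform_entrywise_hasDerivAt hd z) ?_
  · have : bform (Matrix.of fun i j => deriv f (M i j) - deriv f 0) z z
        = bform (entrywise (deriv f) M) z z - bform (Matrix.of fun _ _ => deriv f 0) z z := by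
      simp only [bform, ← Finset.sum_sub_distrib, of_apply, entrywise]
      exact Finset.sum_congr rfl fun i _ => Finset.sum_congr rfl fun j _ => by ring
    rw [this, bform_const] at hnn
    have := mul_nonneg hf0 (sq_nonneg (∑ i, z i))
    linarith
  · obtain ⟨ρ, hρ, haρ⟩ := exists_add_mem_symInterval ha
    filter_upwards [Ioo_mem_nhdsGT hρ] with h hh
    have := hf.bform_increment_nonneg hn hh.1 (a := a)
      (mem_symInterval_of_mem_Icc ha haρ (by linarith [hh.1]) (by linarith [hh.2])) hM hMa z
    rw [← sub_nonneg] at this ⊢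
    refine this.trans (le_of_eq ?_)
    simp only [bform, ← Finset.sum_sub_distrib, of_apply, entrywise]
    exact Finset.sum_congr rfl fun i _ => Finset.sum_congr rfl fun j _ => by
      simp only [add_zero, zero_add]; ring

theorem SConvexOfOrder.monotoneOn_deriv (hn : 2 ≤ n) (hf : SConvexOfOrder n α f) :
    MonotoneOn (deriv f) (nonnegPart α) :=
  (hf.convexOn_nonnegPart hn).monotoneOn_deriv fun _ hx => hf.differentiableAt hn hx.2

/-- The defect of f is nondecreasing in the base point, and its derivative there is the defect of
f'. -/
theorem SConvexOfOrder.convexOn_deriv (hn : 2 ≤ n) (hf : SConvexOfOrder n α f) :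
    ConvexOn ℝ (nonnegPart α) (deriv f) := by
  refine convexOn_of_defect_nonneg (convex_nonnegPart α) fun x hx h hh hxh t ht0 ht1 => ?_
  have hth : t * h ≤ h := mul_le_of_le_one_left hh ht1
  have hth0 : 0 ≤ t * h := mul_nonneg ht0 hh
  have d1 := (hf.differentiableAt hn hxh.2).hasDerivAt.comp_add_const x h
  have d2 := (hf.differentiableAt hn hx.2).hasDerivAt
  have d3 := (hf.differentiableAt hn (mem_symInterval_of_mem_Icc hx.2 hxh.2 (z := x + t * h)
    (by linarith) (by linarith))).hasDerivAt.comp_add_const x (t * h)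
  have hd : HasDerivAt (defect f h t) (defect (deriv f) h t x) x :=
    ((d1.const_mul t).add (d2.const_mul (1 - t))).sub d3
  refine nonneg_of_hasDerivAt_of_eventually_le hd ?_
  obtain ⟨ρ, hρ, hxρ⟩ := exists_add_mem_symInterval hxh.2
  filter_upwards [Ioo_mem_nhdsGT (show x < x + ρ by linarith)] with y hy
  refine (le_abs_self _).trans (hf.abs_defect_le hn ?_ hh ?_ ht0 ht1)
  · rw [abs_of_nonneg hx.1]
    exact hy.1.le
  · exact mem_symInterval_of_mem_Icc hxh.2 hxρ (by linarith [hy.1]) (by linarith [hy.2])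

/-! ### Divided differences as integrals over segments -/

theorem exists_gt_mem_nonnegPart {x : ℝ} (hx : x ∈ nonnegPart α) : ∃ y ∈ nonnegPart α, x < y := by
  obtain ⟨ρ, hρ, hxρ⟩ := exists_add_mem_symInterval hx.2
  have hx0 : 0 ≤ x := hx.1
  exact ⟨x + ρ, ⟨show 0 ≤ x + ρ by linarith, hxρ⟩, by linarith⟩

theorem opNorm_mem_symInterval (hα : 0 < α) {A : Matrix (Fin n) (Fin n) ℝ}
    (hA : (opNorm A : EReal) < α) : opNorm A ∈ symInterval α := by
  refine ⟨(zero_mem_symInterval hα).1.trans_le ?_, hA⟩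
  exact EReal.coe_le_coe_iff.mpr (norm_nonneg _)

theorem add_mul_sub_mem_symInterval {a b t : ℝ} (ha : a ∈ symInterval α) (hb : b ∈ symInterval α)
    (ht : t ∈ Set.Icc (0 : ℝ) 1) : b + t * (a - b) ∈ symInterval α :=
  (convex_symInterval α).add_smul_sub_mem hb ha ht

theorem add_mul_sub_mem_nonnegPart {a b t : ℝ} (ha : a ∈ nonnegPart α) (hb : b ∈ nonnegPart α)
    (ht : t ∈ Set.Icc (0 : ℝ) 1) : b + t * (a - b) ∈ nonnegPart α :=
  (convex_nonnegPart α).add_smul_sub_mem hb ha ht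

theorem SConvexOfOrder.intervalIntegrable_deriv_segment (hn : 2 ≤ n) (hf : SConvexOfOrder n α f)
    {a b : ℝ} (ha : a ∈ symInterval α) (hb : b ∈ symInterval α) :
    IntervalIntegrable (fun t => deriv f (b + t * (a - b))) MeasureTheory.volume 0 1 := by
  refine ContinuousOn.intervalIntegrable ?_
  rw [Set.uIcc_of_le zero_le_one]
  exact (hf.continuousOn_deriv hn).comp (by fun_prop)
    fun t ht => add_mul_sub_mem_symInterval ha hb ht

theorem SConvexOfOrder.integral_deriv_segment_mul (hn : 2 ≤ n) (hf : SConvexOfOrder n α f)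
    {a b : ℝ} (ha : a ∈ symInterval α) (hb : b ∈ symInterval α) :
    (∫ t in (0 : ℝ)..1, deriv f (b + t * (a - b))) * (a - b) = f a - f b := by
  rw [← intervalIntegral.integral_mul_const,
    intervalIntegral.integral_eq_sub_of_hasDerivAt (f := fun t => f (b + t * (a - b)))]
  · simp
  · intro t ht
    rw [Set.uIcc_of_le zero_le_one] at ht
    have l : HasDerivAt (fun t : ℝ => b + t * (a - b)) (a - b) t := by
      simpa using ((hasDerivAt_id t).mul_const (a - b)).const_add b
    exact (hf.differentiableAt hn (add_mul_sub_mem_symInterval ha hb ht)).hasDerivAt.comp t l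
  · exact (hf.intervalIntegrable_deriv_segment hn ha hb).mul_const _

theorem SConvexOfOrder.divDiff_eq_integral (hn : 2 ≤ n) (hf : SConvexOfOrder n α f)
    {a b : ℝ} (ha : a ∈ symInterval α) (hb : b ∈ symInterval α) :
    divDiff f a b = ∫ t in (0 : ℝ)..1, deriv f (b + t * (a - b)) := by
  rw [divDiff]
  split_ifs with h
  · simp [h]
  · rw [← hf.integral_deriv_segment_mul hn ha hb, mul_div_cancel_right₀ _ (sub_ne_zero.mpr h)]

theorem SConvexOfOrder.divDiff_nonneg (hn : 2 ≤ n) (hf : SConvexOfOrder n α f) (hα : 0 < α)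
    (hf0 : 0 ≤ deriv f 0) {a b : ℝ} (ha : a ∈ nonnegPart α) (hb : b ∈ nonnegPart α) :
    0 ≤ divDiff f a b := by
  rw [hf.divDiff_eq_integral hn ha.2 hb.2]
  refine intervalIntegral.integral_nonneg zero_le_one fun t ht => ?_
  have h := add_mul_sub_mem_nonnegPart ha hb ht
  exact hf0.trans (hf.monotoneOn_deriv hn ⟨le_refl (0 : ℝ), zero_mem_symInterval hα⟩ h h.1)

theorem SConvexOfOrder.divDiff_mono (hn : 2 ≤ n) (hf : SConvexOfOrder n α f)
    {a b a' b' : ℝ} (ha : a ∈ nonnegPart α) (hb : b ∈ nonnegPart α) (ha' : a' ∈ nonnegPart α)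
    (hb' : b' ∈ nonnegPart α) (haa : a ≤ a') (hbb : b ≤ b') : divDiff f a b ≤ divDiff f a' b' := by
  rw [hf.divDiff_eq_integral hn ha.2 hb.2, hf.divDiff_eq_integral hn ha'.2 hb'.2]
  refine intervalIntegral.integral_mono_on zero_le_one
    (hf.intervalIntegrable_deriv_segment hn ha.2 hb.2)
    (hf.intervalIntegrable_deriv_segment hn ha'.2 hb'.2) fun t ht => ?_
  refine hf.monotoneOn_deriv hn (add_mul_sub_mem_nonnegPart ha hb ht)
    (add_mul_sub_mem_nonnegPart ha' hb' ht) ?_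
  nlinarith [mul_le_mul_of_nonneg_left haa ht.1,
    mul_le_mul_of_nonneg_left hbb (sub_nonneg.mpr ht.2)]

theorem headSum_segment (a b : Fin n → ℝ) (t : ℝ) (m : ℕ) :
    headSum (fun i => b i + t * (a i - b i)) m
      = headSum b m + t * (headSum a m - headSum b m) := by
  simp only [headSum, Finset.mul_sum, ← Finset.sum_add_distrib, ← Finset.sum_sub_distrib]
  exact Finset.sum_congr rfl fun i _ => by split_ifs <;> ring

theorem intervalIntegrable_sum_apply {ι : Type*} (s : Finset ι) {g : ι → ℝ → ℝ} {a b : ℝ}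
    (hg : ∀ i ∈ s, IntervalIntegrable (g i) MeasureTheory.volume a b) :
    IntervalIntegrable (fun t => ∑ i ∈ s, g i t) MeasureTheory.volume a b := by
  have := IntervalIntegrable.sum s hg
  rwa [show (∑ i ∈ s, g i) = fun t => ∑ i ∈ s, g i t by funext t; simp] at this

/-! ### The main estimate -/

theorem SConvexOfOrder.headSum_sing_sub_le (hn : 2 ≤ n) (hα : 0 < α)
    (hf : SConvexOfOrder n α f) (hf0 : 0 ≤ deriv f 0) {A B : Matrix (Fin n) (Fin n) ℝ}
    (hA : A.PosSemidef) (hB : B.PosSemidef) (hAα : (opNorm A : EReal) < α)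
    (hBα : (opNorm B : EReal) < α) {m : ℕ} (hm : m ≤ n) :
    headSum (sing (entrywise f A - entrywise f B)) m ≤ headSum (fun i =>
      divDiff f (eigs hA.isHermitian i) (eigs hB.isHermitian i) * sing (A - B) i) m := by
  have hAI := opNorm_mem_symInterval hα hAα
  have hBI := opNorm_mem_symInterval hα hBα
  have hAij : ∀ i j, A i j ∈ symInterval α := fun i j =>
    mem_symInterval_of_abs_le hAI (abs_apply_le_opNorm A i j)
  have hBij : ∀ i j, B i j ∈ symInterval α := fun i j =>
    mem_symInterval_of_abs_le hBI (abs_apply_le_opNorm B i j)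
  have hAe : ∀ i, eigs hA.isHermitian i ∈ nonnegPart α := fun i =>
    ⟨eigs_nonneg hA i, mem_symInterval_of_abs_le hAI (abs_eigs_le_opNorm _ i)⟩
  have hBe : ∀ i, eigs hB.isHermitian i ∈ nonnegPart α := fun i =>
    ⟨eigs_nonneg hB i, mem_symInterval_of_abs_le hBI (abs_eigs_le_opNorm _ i)⟩
  let C : Matrix (Fin n) (Fin n) ℝ :=
    Matrix.of fun i j => ∫ t in (0 : ℝ)..1, deriv f (B i j + t * (A i j - B i j))
  have hint : ∀ i j, IntervalIntegrable (fun t => deriv f (B i j + t * (A i j - B i j)))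
      MeasureTheory.volume 0 1 := fun i j =>
    hf.intervalIntegrable_deriv_segment hn (hAij i j) (hBij i j)
  have hprod : entrywise f A - entrywise f B = C ⊙ (A - B) := by
    ext i j
    exact (hf.integral_deriv_segment_mul hn (hAij i j) (hBij i j)).symm
  have hC : C.PosSemidef := by
    rw [posSemidef_iff_bform]
    refine ⟨?_, fun z => ?_⟩
    · ext i j
      simp only [C, transpose_apply, of_apply, apply_comm_of_posSemidef hA j i,
        apply_comm_of_posSemidef hB j i]
    · have hbf : bform C z z = ∫ t in (0 : ℝ)..1,
          bform (entrywise (deriv f) (B + t • (A - B))) z z := by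
        simp only [bform, C, entrywise, of_apply, Matrix.add_apply, Matrix.smul_apply,
          Matrix.sub_apply, smul_eq_mul]
        have hi : ∀ i j, IntervalIntegrable
            (fun t => z i * deriv f (B i j + t * (A i j - B i j)) * z j)
            MeasureTheory.volume 0 1 := fun i j => ((hint i j).const_mul (z i)).mul_const (z j)
        rw [intervalIntegral.integral_finsetSum fun i _ =>
          intervalIntegrable_sum_apply univ fun j _ => hi i j]
        refine Finset.sum_congr rfl fun i _ => ?_
        rw [intervalIntegral.integral_finsetSum fun j _ => hi i j]
        exact Finset.sum_congr rfl fun j _ => by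
          rw [intervalIntegral.integral_mul_const, intervalIntegral.integral_const_mul]
      rw [hbf]
      refine intervalIntegral.integral_nonneg zero_le_one fun t ht => ?_
      have hM : (B + t • (A - B)).PosSemidef := by
        have := (hB.smul (sub_nonneg.mpr ht.2)).add (hA.smul ht.1)
        convert! this using 1
        module
      -- One bound for the entries of every matrix on the segment, as required by `SPositiveOn`.
      have hmax : max (opNorm A) (opNorm B) ∈ symInterval α := by
        rcases max_choice (opNorm A) (opNorm B) with h | h <;> rwa [h]
      refine ((posSemidef_iff_bform _).mp
        (hf.sPositiveOn_deriv hn hf0 hmax _ hM fun i j => ?_)).2 z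
      have h1 := (abs_apply_le_opNorm A i j).trans (le_max_left _ (opNorm B))
      have h2 := (abs_apply_le_opNorm B i j).trans (le_max_right (opNorm A) _)
      have := (convex_Icc (-(max (opNorm A) (opNorm B))) (max (opNorm A) (opNorm B))).add_smul_sub_mem
        (abs_le.mp h2) (abs_le.mp h1) ht
      exact abs_le.mpr this
  have hd : ∀ T : Finset (Fin n), ∑ i ∈ T, C i i ≤ headSum (fun i =>
      divDiff f (eigs hA.isHermitian i) (eigs hB.isHermitian i)) T.card := by
    intro T
    have hints : ∀ j : Fin n, IntervalIntegrable (fun t => if (j : ℕ) < T.card then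
        deriv f (eigs hB.isHermitian j + t * (eigs hA.isHermitian j - eigs hB.isHermitian j))
        else 0) MeasureTheory.volume 0 1 := by
      intro j
      split_ifs
      · exact hf.intervalIntegrable_deriv_segment hn (hAe j).2 (hBe j).2
      · exact intervalIntegrable_const
    have hrhs : headSum (fun i => divDiff f (eigs hA.isHermitian i) (eigs hB.isHermitian i)) T.card
        = ∫ t in (0 : ℝ)..1, headSum (fun j => deriv f (eigs hB.isHermitian j
          + t * (eigs hA.isHermitian j - eigs hB.isHermitian j))) T.card := by
      simp only [headSum]
      rw [intervalIntegral.integral_finsetSum fun j _ => hints j]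
      refine Finset.sum_congr rfl fun j _ => ?_
      split_ifs
      · exact hf.divDiff_eq_integral hn (hAe j).2 (hBe j).2
      · simp
    rw [hrhs]
    simp only [C, of_apply]
    rw [← intervalIntegral.integral_finsetSum fun i _ => hint i i]
    refine intervalIntegral.integral_mono_on zero_le_one
      (intervalIntegrable_sum_apply T fun i _ => hint i i)
      (intervalIntegrable_sum_apply univ fun j _ => hints j)
      fun t ht => ?_
    -- At fixed t, Schur's inequalities for A and B combine with weights t and 1 - t; the decreasing
    -- orders of the two spectra are paired index by index.
    refine sum_convex_le_headSum (hf.convexOn_deriv hn) (hf.monotoneOn_deriv hn)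
      (fun x hx => exists_gt_mem_nonnegPart hx)
      (d := fun i => B i i + t * (A i i - B i i))
      (fun i => add_mul_sub_mem_nonnegPart ⟨hA.diag_nonneg, hAij i i⟩ ⟨hB.diag_nonneg, hBij i i⟩ ht)
      (fun i => add_mul_sub_mem_nonnegPart (hAe i) (hBe i) ht) (fun R => ?_) T
    rw [headSum_segment, Finset.sum_add_distrib, ← Finset.mul_sum, Finset.sum_sub_distrib]
    nlinarith [mul_le_mul_of_nonneg_left (sum_diag_le_headSum_eigs hA R) ht.1,
      mul_le_mul_of_nonneg_left (sum_diag_le_headSum_eigs hB R) (sub_nonneg.mpr ht.2)]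
  rw [hprod]
  exact headSum_sing_hadamard_le hC (A - B) hd hm

/-- Ensures that the partial sums of the right-hand vector are already its largest ones. Divided
differences increase in both arguments because f' is nondecreasing on the nonnegative part. -/
theorem SConvexOfOrder.antitone_divDiff_mul_sing (hn : 2 ≤ n) (hα : 0 < α)
    (hf : SConvexOfOrder n α f) (hf0 : 0 ≤ deriv f 0) {A B : Matrix (Fin n) (Fin n) ℝ}
    (hA : A.PosSemidef) (hB : B.PosSemidef) (hAα : (opNorm A : EReal) < α)
    (hBα : (opNorm B : EReal) < α) : Antitone fun i =>
      divDiff f (eigs hA.isHermitian i) (eigs hB.isHermitian i) * sing (A - B) i := by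
  have hAe : ∀ i, eigs hA.isHermitian i ∈ nonnegPart α := fun i => ⟨eigs_nonneg hA i,
    mem_symInterval_of_abs_le (opNorm_mem_symInterval hα hAα) (abs_eigs_le_opNorm _ i)⟩
  have hBe : ∀ i, eigs hB.isHermitian i ∈ nonnegPart α := fun i => ⟨eigs_nonneg hB i,
    mem_symInterval_of_abs_le (opNorm_mem_symInterval hα hBα) (abs_eigs_le_opNorm _ i)⟩
  intro i j hij
  exact mul_le_mul (hf.divDiff_mono hn (hAe j) (hBe j) (hAe i) (hBe i)
    (eigs_antitone _ hij) (eigs_antitone _ hij)) (sing_antitone _ hij) (sing_nonneg _ _)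
    (hf.divDiff_nonneg hn hα hf0 (hAe i) (hBe i))

end

end SchurCalc

end
theorem theorem6p3 (n : ℕ) (hn : 2 ≤ n) (α : EReal) (hα : 0 < α) (f : ℝ → ℝ)
    (hf : SchurCalc.SConvexOfOrder n α f) (hf0 : 0 ≤ deriv f 0) :
    (∀ x ∈ SchurCalc.symInterval α, DifferentiableAt ℝ f x) ∧
    ∀ (A B : Matrix (Fin n) (Fin n) ℝ) (hA : A.PosSemidef) (hB : B.PosSemidef),
      (SchurCalc.opNorm A : EReal) < α → (SchurCalc.opNorm B : EReal) < α →
      SchurCalc.WeakMaj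
        (SchurCalc.sing (SchurCalc.entrywise f A - SchurCalc.entrywise f B))
        (fun i => SchurCalc.divDiff f (SchurCalc.eigs hA.isHermitian i)
            (SchurCalc.eigs hB.isHermitian i) * SchurCalc.sing (A - B) i) := by
  refine ⟨fun x hx => hf.differentiableAt hn hx, fun A B hA hB hAα hBα k => ?_⟩
  -- Both vectors are already decreasing, so weak majorization is a comparison of sums of the first
  -- k + 1 coordinates, and k + 1 ≤ n.
  rw [SchurCalc.decr_eq_self_of_antitone (SchurCalc.sing_antitone _),
    SchurCalc.decr_eq_self_of_antitone (hf.antitone_divDiff_mul_sing hn hα hf0 hA hB hAα hBα),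
    SchurCalc.sum_Iic_eq_headSum, SchurCalc.sum_Iic_eq_headSum]
  exact hf.headSum_sing_sub_le hn hα hf0 hA hB hAα hBα k.isLt
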